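/- **Setting.** Let $0<R<1$ and let $\Delta_V,\Delta_C$ be fixed positive integers with $R=1-\Delta_V/\Delta_C$. A $(\Delta_V,\Delta_C)$-regular bipartite graph $\mathcal G=((V,C),\mathcal E)$ with $n$ variable nodes $V$ and $n\Delta_V/\Delta_C=n(1-R)$ check nodes $C$ is a graph without multiple edges in which every $v\in V$ has degree $\Delta_V$ and every $c\in C$ has degree $\Delta_C$; $N(\cdot)$ denotes neighbourhoods. Given positive reals with $1\le\alpha<A$, $\frac1{1-R}<\beta<\min\{\frac2{1-R},B\}$, $0<\epsilon<\frac{1-R}{A}$, $0<\vartheta<\frac1{B(1-R)}$, $\mathcal G$ is *$(\alpha,A,\beta,B,\epsilon,\vartheta)$-good* if for all $S\subset V$ and $T\subset C$: (L1) $|S|\le\lceil\epsilon n\rceil\Rightarrow|N(S)|\ge A|S|$; (L2) $|S|\le\lceil\frac{n(1-R)}{2\alpha}\rceil\Rightarrow|N(S)|\ge\alpha|S|$; (R1) $|T|\le\vartheta n(1-R)\Rightarrow|N(T)|\ge B|T|$; (R2) $|T|\le\frac{n(1-R)}2\Rightarrow|N(T)|\ge\beta|T|$. **Ensemble.** Let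 $\lambda>0$ and let $p=p_n$ be the smallest prime greater than $n^\lambda$. Let $\widehat H\in\{0,1\}^{n(1-R)\times n}$ be the matrix whose $(i,j)$ entry is $1$ iff check $i$ and variable $j$ are adjacent in $\mathcal G$. The $(\mathcal G,\lambda)$ LDA ensemble is the law of the random lattice $$\Lambda=\{x\in\mathbb Z^n: Hx\equiv 0 \bmod p\},\qquad H_{ij}=\widehat H_{ij}h'_{ij},$$ with $h'_{ij}$ i.i.d. uniform on $\mathbb F_p$ (Construction A applied to the code with parity check matrix $H$). For a full-rank lattice $\Lambda\subset\mathbb R^n$ with fundamental Voronoi region $\mathcal V(\Lambda)$ (the points for which $0$ is a closest lattice point, ties being resolved by a fixed rule) and $\mathrm{vol}(\Lambda)=\mathrm{vol}(\mathcal V(\Lambda))$, let $$G(\Lambda)=\frac1{n\,\mathrm{vol}(\Lambda)^{1+2/n}}\int_{\mathcal V(\Lambda)}\|y\|^2\,dy .$$ **Theorem.** Let $\alpha,A,\beta,B$ satisfy $1\le\alpha<A$ and $\frac1{1-R}<\beta<\min\{\frac2{1-R},B\}$, and let $A>2(1+R)$, $B>\frac{2(1+R)}{1-R}$, $\epsilon=\frac{1-R}{A+1-R}$,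 $\vartheta=\frac1{B(1-R)+1}$. With $h_2(a)=-a\log_2a-(1-a)\log_2(1-a)$, suppose that $$\begin{aligned}\Delta_V>\max\Big\{&\tfrac{h_2(\frac{1-R}{2\alpha})+1-R}{h_2(\frac{1-R}{2\alpha})-\frac12h_2(\frac{1-R}{\alpha})},\ R+2\alpha,\ A+1,\ \tfrac{h_2(\epsilon)+(1-R)h_2(\frac{A\epsilon}{1-R})}{h_2(\epsilon)-\frac{A\epsilon}{1-R}h_2(\frac{1-R}{A})},\ \tfrac{1-R+h_2(\frac{\beta(1-R)}2)}{1-\frac{\beta(1-R)}2h_2(\frac1{\beta(1-R)})},\ \tfrac{(2+\beta R)(1-R)}{2-\beta(1-R)},\\&(1-R)(B+1),\ \tfrac{(1-R)h_2(\vartheta)+h_2(B\vartheta(1-R))}{h_2(\vartheta)-B\vartheta(1-R)h_2(\frac1{B(1-R)})},\ \tfrac{(A+1)(1-R)-A\epsilon(2-R)}{1-R-A\epsilon},\ \tfrac{B+1-\vartheta B(2-R)}{\frac1{1-R}-\vartheta B}\Big\}\end{aligned}$$ and $$\lambda>\max\Big\{\tfrac1R,\ \tfrac1{1-R},\ \tfrac2{A-2(1+R)},\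 \tfrac2{B(1-R)-2(1+R)},\ 2\big(1-\tfrac1{AB-1}-\tfrac1A\big)^{-1}\Big\}.$$ Let $\mathcal I\subset\mathbb Z_{\ge 0}$ be infinite and, for $n\in\mathcal I$, let $\mathcal G^{(n)}$ be a $(\Delta_V,\Delta_C)$-regular bipartite graph with $n$ variable nodes and $n(1-R)$ check nodes that is $(\alpha,A,\beta,B,\epsilon,\vartheta)$-good. If $\Lambda^{(n)}$ is drawn from the $(\mathcal G^{(n)},\lambda)$ LDA ensemble, then $\Lambda^{(n)}$ is good for MSE quantization with probability tending to $1$, that is, for every $\delta>0$, $$\Pr\Big[\big|G(\Lambda^{(n)})-\tfrac1{2\pi e}\big|\le\delta\Big]\longrightarrow1\qquad(n\to\infty,\ n\in\mathcal I).$$ -/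

import Mathlib

open Filter Topology MeasureTheory

noncomputable section

namespace LDA

/-! ### Lattices, Voronoi regions, normalized second moment -/

/-- The fundamental Voronoi region of a lattice `L` of `ℝⁿ`: the points for which `0` is a closest
lattice point in Euclidean norm. Points with ties form a Lebesgue null set for a full-rank lattice,
so the rule deciding ties affects neither its volume nor integrals over it. -/
def voronoi {n : ℕ} (L : Submodule ℤ (EuclideanSpace ℝ (Fin n))) :
    Set (EuclideanSpace ℝ (Fin n)) :=
  {x | ∀ y ∈ L, ‖x‖ ≤ ‖x - y‖}

/-- The volume of the fundamental Voronoi region. -/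
def vol {n : ℕ} (L : Submodule ℤ (EuclideanSpace ℝ (Fin n))) : ℝ :=
  (volume (voronoi L)).toReal

/-- The normalized second moment per dimension,
`G(L) = (n vol(L)^(1+2/n))⁻¹ ∫_{V(L)} ‖y‖² dy`. -/
def secondMoment {n : ℕ} (L : Submodule ℤ (EuclideanSpace ℝ (Fin n))) : ℝ :=
  1 / ((n : ℝ) * vol L ^ (1 + 2 / (n : ℝ))) * ∫ y in voronoi L, ‖y‖ ^ 2

/-- Construction A: the integer vectors whose reduction modulo `p` is a codeword of `K`. -/
def constructionA {n p : ℕ} (K : Submodule (ZMod p) (Fin n → ZMod p)) :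
    Submodule ℤ (EuclideanSpace ℝ (Fin n)) where
  carrier := {x | ∃ z : Fin n → ℤ, (∀ i, x i = (z i : ℝ)) ∧ (fun i => (z i : ZMod p)) ∈ K}
  zero_mem' := by
    refine ⟨0, fun i => by simp, ?_⟩
    have h := K.zero_mem
    convert h using 1
    funext i
    simp
  add_mem' := by
    rintro x y ⟨z, hz, hzK⟩ ⟨w, hw, hwK⟩
    refine ⟨z + w, fun i => by simp [hz i, hw i], ?_⟩
    have h := K.add_mem hzK hwK
    convert h using 1
    funext i
    simp
  smul_mem' := by
    rintro c x ⟨z, hz, hzK⟩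
    refine ⟨c • z, fun i => by simp [hz i], ?_⟩
    have h := K.smul_mem (c : ZMod p) hzK
    convert h using 1
    funext i
    simp

/-! ### Bipartite (Tanner) graphs and their expansion -/

/-- A bipartite graph with left vertices `V` (variable nodes) and right vertices `C`
(check nodes). -/
structure BipGraph (V C : Type) where
  /-- `Adj v c` says that the variable node `v` and the check node `c` are joined by an edge. -/
  Adj : V → C → Prop

namespace BipGraph

variable {V C : Type} [Fintype V] [Fintype C]

open Classical in
/-- The neighbourhood of a set of left vertices. -/
def nbrOfLeft (g : BipGraph V C) (S : Finset V) : Finset C :=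
  Finset.univ.filter fun c => ∃ v ∈ S, g.Adj v c

open Classical in
/-- The neighbourhood of a set of right vertices. -/
def nbrOfRight (g : BipGraph V C) (T : Finset C) : Finset V :=
  Finset.univ.filter fun v => ∃ c ∈ T, g.Adj v c

/-- Every left vertex has degree `dV` and every right vertex has degree `dC`. -/
def IsBiregular (g : BipGraph V C) (dV dC : ℕ) : Prop :=
  (∀ v : V, (g.nbrOfLeft {v}).card = dV) ∧ (∀ c : C, (g.nbrOfRight {c}).card = dC)

/-- The expansion properties (L1), (L2), (R1), (R2) of an `(α, A, β, B, ε, ϑ)`-good graph of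
rate `R`, with `n = |V|` variable nodes. -/
structure IsGood (g : BipGraph V C) (R α A β B ε ϑ : ℝ) : Prop where
  left_small : ∀ S : Finset V, S.card ≤ ⌈ε * (Fintype.card V : ℝ)⌉₊ →
    A * (S.card : ℝ) ≤ ((g.nbrOfLeft S).card : ℝ)
  left_large : ∀ S : Finset V, S.card ≤ ⌈(Fintype.card V : ℝ) * (1 - R) / (2 * α)⌉₊ →
    α * (S.card : ℝ) ≤ ((g.nbrOfLeft S).card : ℝ)
  right_small : ∀ T : Finset C, (T.card : ℝ) ≤ ϑ * (Fintype.card V : ℝ) * (1 - R) →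
    B * (T.card : ℝ) ≤ ((g.nbrOfRight T).card : ℝ)
  right_large : ∀ T : Finset C, (T.card : ℝ) ≤ (Fintype.card V : ℝ) * (1 - R) / 2 →
    β * (T.card : ℝ) ≤ ((g.nbrOfRight T).card : ℝ)

open Classical in
/-- The 0/1 parity check matrix `Ĥ` of the Tanner graph, with entries in `ZMod p`. -/
def skeleton (g : BipGraph V C) (p : ℕ) : Matrix C V (ZMod p) :=
  Matrix.of fun c v => if g.Adj v c then 1 else 0

end BipGraph

/-- The binary entropy function (logarithm to base 2). -/
def h2 (a : ℝ) : ℝ := -a * Real.logb 2 a - (1 - a) * Real.logb 2 (1 - a)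

/-- The lower bounds imposed on the left degree `dV` (the left degree exceeds the maximum of
the ten quantities). -/
structure DegreeCondition (dV : ℕ) (R α A β B ε ϑ : ℝ) : Prop where
  c1 : (h2 ((1 - R) / (2 * α)) + 1 - R) /
      (h2 ((1 - R) / (2 * α)) - 1 / 2 * h2 ((1 - R) / α)) < (dV : ℝ)
  c2 : R + 2 * α < (dV : ℝ)
  c3 : A + 1 < (dV : ℝ)
  c4 : (h2 ε + (1 - R) * h2 (A * ε / (1 - R))) /
      (h2 ε - A * ε / (1 - R) * h2 ((1 - R) / A)) < (dV : ℝ)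
  c5 : (1 - R + h2 (β * (1 - R) / 2)) /
      (1 - β * (1 - R) / 2 * h2 (1 / (β * (1 - R)))) < (dV : ℝ)
  c6 : (2 + β * R) * (1 - R) / (2 - β * (1 - R)) < (dV : ℝ)
  c7 : (1 - R) * (B + 1) < (dV : ℝ)
  c8 : ((1 - R) * h2 ϑ + h2 (B * ϑ * (1 - R))) /
      (h2 ϑ - B * ϑ * (1 - R) * h2 (1 / (B * (1 - R)))) < (dV : ℝ)
  c9 : ((A + 1) * (1 - R) - A * ε * (2 - R)) / (1 - R - A * ε) < (dV : ℝ)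
  c10 : (B + 1 - ϑ * B * (2 - R)) / (1 / (1 - R) - ϑ * B) < (dV : ℝ)

/-! ### The random ensemble -/

theorem exists_prime_gt (lam : ℝ) (n : ℕ) : ∃ q : ℕ, q.Prime ∧ (n : ℝ) ^ lam < (q : ℝ) := by
  obtain ⟨q, hq, hp⟩ := Nat.exists_infinite_primes (⌊(n : ℝ) ^ lam⌋₊ + 1)
  exact ⟨q, hp, (Nat.lt_floor_add_one _).trans_le (by exact_mod_cast hq)⟩

open Classical in
/-- The smallest prime number greater than `n ^ lam`. -/
def fieldSize (lam : ℝ) (n : ℕ) : ℕ := Nat.find (exists_prime_gt lam n)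

theorem fieldSize_prime (lam : ℝ) (n : ℕ) : (fieldSize lam n).Prime := by
  classical
  exact (Nat.find_spec (exists_prime_gt lam n)).1

instance (lam : ℝ) (n : ℕ) : Fact (fieldSize lam n).Prime := ⟨fieldSize_prime lam n⟩

/-- The lattice obtained from the coefficients `h'` (one for each pair check/variable): the
parity check matrix is `H = Ĥ ⊙ h'` (entrywise product), the code is the kernel of `H`,
and the lattice is obtained by Construction A. -/
def latticeOf {n m p : ℕ} (g : BipGraph (Fin n) (Fin m)) (h' : Matrix (Fin m) (Fin n) (ZMod p)) :
    Submodule ℤ (EuclideanSpace ℝ (Fin n)) :=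
  constructionA (LinearMap.ker (Matrix.mulVecLin (Matrix.hadamard (g.skeleton p) h')))

/-- The `(g, lam)` LDA ensemble: the law of `latticeOf g h'`, where the entries of `h'` are
i.i.d. uniform on `𝔽_p` (that is, `h'` is uniform on the finite set of all matrices), with `p` the
smallest prime greater than `n ^ lam`. -/
def ensemble {n m : ℕ} (g : BipGraph (Fin n) (Fin m)) (lam : ℝ) :
    PMF (Submodule ℤ (EuclideanSpace ℝ (Fin n))) :=
  (PMF.uniformOfFintype (Fin m → Fin n → ZMod (fieldSize lam n))).map
    fun h' => latticeOf g (Matrix.of h')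

end LDA

end

open Filter Topology MeasureTheory

namespace LDA

/-! ### Voronoi regions as fundamental domains, compared with the cube `[0, p)ⁿ`. -/

section Geometry

variable {n p : ℕ}

/-! The bound `G ≥ 1/(2πe)` holds for each of these lattices (`le_secondMoment`): a density spread
uniformly over a set of volume `v` has entropy `log v`, and a Gaussian maximizes entropy for a given
second moment. What needs proof is the upper bound, and this is a covering statement.

The second moment of the Voronoi region is the integral of the squared distance to the lattice over
any fundamental domain, hence `1/|K|` times its integral over `[0, p)ⁿ`. If `|K| = p^(n-m)` and all
but a proportion `X` of the residue vectors lie within `r` of the code, then `G` is at most `(r +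
√n)²/(n p^(2(1-R))) + p^(2R) X` (`secondMoment_le`). It must be shown that `p^(2R) X → 0` in mean
for an `r` for which the first term is close to `1/(2πe)`.

This is a second moment argument. Displacements `u` are weighted by `exp(-a‖u‖²)`, restricted to a
thin shell around the typical norm, and the weighted number of codewords near a random residue
vector is compared with its mean. After averaging over the coefficients, `v` is a codeword with
probability `p^(s-m)`, where `s` counts the checks that see only zeros of `v`. A union bound over
sets `T` of such checks leaves the sum of `p^|T|` times the probability that two independent
displacements agree on `N(T)` (`avg_card_uncovered_le`).

Let `θ` be the one-dimensional theta sum, of order `p^(1-R)`. Agreement on `Z` has probability at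
most `2 θ^(-|Z|)`, which suffices for `|T|` up to half the checks because `|N(T)| ≥ B|T|` or `|N(T)|
≥ β|T|`. For larger `T` this bound loses a factor exponential in `n`: near full agreement the
relevant count is that of the shell points, heuristically `e^(n/2) θⁿ` and not `θⁿ`. The shell
restriction recovers this factor (`collision_shell_le` with `b` near `a`), and left expansion gives
`n - |N(T)| ≤ m - |T|`. The parameter `a` puts slightly more than `p^m` points in the shell.

The same union bound for a uniform residue vector shows that `|K| = p^(n-m)` with probability
tending to one, and Markov's inequality combines the two averages. -/

theorem voronoi_isClosed (L : Submodule ℤ (EuclideanSpace ℝ (Fin n))) : IsClosed (voronoi L) := by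
  have : voronoi L = ⋂ y ∈ L, {x | ‖x‖ ≤ ‖x - y‖} := by
    ext x; simp [voronoi]
  rw [this]
  exact isClosed_biInter fun y _ => isClosed_le (by fun_prop) (by fun_prop)

/-- The integer vector with coordinates `z`, as a point of `ℝⁿ`. -/
def intPoint (z : Fin n → ℤ) : EuclideanSpace ℝ (Fin n) := WithLp.toLp 2 fun i => (z i : ℝ)

@[simp] theorem intPoint_apply (z : Fin n → ℤ) (i : Fin n) : intPoint z i = (z i : ℝ) := rfl

theorem intPoint_injective : Function.Injective (intPoint (n := n)) := by
  intro z w h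
  funext i
  have : (z i : ℝ) = w i := by rw [← intPoint_apply, h, intPoint_apply]
  exact_mod_cast this

theorem mem_constructionA {K : Submodule (ZMod p) (Fin n → ZMod p)}
    {x : EuclideanSpace ℝ (Fin n)} :
    x ∈ constructionA K ↔ ∃ z : Fin n → ℤ, x = intPoint z ∧ (fun i => (z i : ZMod p)) ∈ K := by
  constructor
  · rintro ⟨z, hz, hK⟩
    exact ⟨z, by ext i; simp [hz i], hK⟩
  · rintro ⟨z, rfl, hK⟩
    exact ⟨z, fun i => rfl, hK⟩

theorem intPoint_mem_constructionA {K : Submodule (ZMod p) (Fin n → ZMod p)} {z : Fin n → ℤ} :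
    intPoint z ∈ constructionA K ↔ (fun i => (z i : ZMod p)) ∈ K := by
  rw [mem_constructionA]
  constructor
  · rintro ⟨w, hw, h⟩
    rwa [intPoint_injective hw]
  · exact fun h => ⟨z, rfl, h⟩

instance (K : Submodule (ZMod p) (Fin n → ZMod p)) : Countable (constructionA K) := by
  have : (constructionA K : Set (EuclideanSpace ℝ (Fin n))) ⊆ Set.range intPoint := by
    intro x hx
    obtain ⟨z, rfl, -⟩ := mem_constructionA.1 hx
    exact ⟨z, rfl⟩
  exact ((Set.countable_range intPoint).mono this).to_subtype

/-- Distinct integer points are at distance at least 1. Closedness provides a nearest lattice point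
to every point of space. -/
theorem constructionA_isClosed (K : Submodule (ZMod p) (Fin n → ZMod p)) :
    IsClosed (constructionA K : Set (EuclideanSpace ℝ (Fin n))) := by
  refine Metric.isClosed_of_pairwise_le_dist (ε := 1) one_pos ?_
  intro x hx y hy hxy
  obtain ⟨z, rfl, -⟩ := mem_constructionA.1 hx
  obtain ⟨w, rfl, -⟩ := mem_constructionA.1 hy
  obtain ⟨i, hi⟩ : ∃ i, z i ≠ w i := by
    by_contra! h
    exact hxy (congrArg _ (funext h))
  rw [dist_eq_norm]
  refine le_trans ?_ (PiLp.norm_apply_le (intPoint z - intPoint w) i)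
  have : (1 : ℤ) ≤ |z i - w i| := Int.one_le_abs (sub_ne_zero.2 hi)
  simp only [PiLp.sub_apply, intPoint_apply, Real.norm_eq_abs]
  exact_mod_cast this

theorem exists_sub_mem_voronoi (K : Submodule (ZMod p) (Fin n → ZMod p))
    (x : EuclideanSpace ℝ (Fin n)) :
    ∃ y ∈ constructionA K, x - y ∈ voronoi (constructionA K) := by
  obtain ⟨y, hy, h⟩ := (constructionA_isClosed K).exists_infDist_eq_dist ⟨0, Submodule.zero_mem _⟩ x
  refine ⟨y, hy, fun z hz => ?_⟩
  have := Metric.infDist_le_dist_of_mem (x := x)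
    (show y + z ∈ (constructionA K : Set _) from Submodule.add_mem _ hy hz)
  rw [h, dist_eq_norm, dist_eq_norm] at this
  rwa [sub_sub]

/-- The perpendicular bisector of two distinct points is a null set. -/
theorem volume_bisector {y : EuclideanSpace ℝ (Fin n)} (hy : y ≠ 0) :
    volume {x : EuclideanSpace ℝ (Fin n) | ‖x‖ = ‖x - y‖} = 0 := by
  have : {x : EuclideanSpace ℝ (Fin n) | ‖x‖ = ‖x - y‖}
      = (AffineSubspace.perpBisector (0 : EuclideanSpace ℝ (Fin n)) y : Set _) := by
    ext x
    simp [AffineSubspace.mem_perpBisector_iff_dist_eq, dist_eq_norm]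
  rw [this]
  exact Measure.addHaar_affineSubspace _ _ (by simpa using hy.symm)

instance (L : Submodule ℤ (EuclideanSpace ℝ (Fin n))) :
    VAddInvariantMeasure L (EuclideanSpace ℝ (Fin n)) volume :=
  inferInstanceAs (VAddInvariantMeasure L.toAddSubgroup (EuclideanSpace ℝ (Fin n)) volume)

instance (L : Submodule ℤ (EuclideanSpace ℝ (Fin n))) :
    MeasurableConstVAdd L (EuclideanSpace ℝ (Fin n)) :=
  inferInstanceAs (MeasurableConstVAdd L.toAddSubgroup (EuclideanSpace ℝ (Fin n)))

-- Subtracting a nearest lattice point brings any point into the region, so the translates cover. A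
-- point common to two translates is equidistant from their centres, so the overlap lies in a
-- hyperplane; this is why ties do not matter.
open scoped Pointwise in
theorem isAddFundamentalDomain_voronoi (K : Submodule (ZMod p) (Fin n → ZMod p)) :
    IsAddFundamentalDomain (constructionA K) (voronoi (constructionA K))
      (volume : Measure (EuclideanSpace ℝ (Fin n))) where
  nullMeasurableSet := (voronoi_isClosed _).measurableSet.nullMeasurableSet
  ae_covers := ae_of_all _ fun x => by
    obtain ⟨y, hy, h⟩ := exists_sub_mem_voronoi K x
    refine ⟨-⟨y, hy⟩, ?_⟩
    have : (-(⟨y, hy⟩ : constructionA K)) +ᵥ x = x - y := by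
      change -y + x = x - y
      abel
    rwa [this]
  aedisjoint := by
    rintro ⟨y, hy⟩ ⟨z, hz⟩ hyz
    have hne : z - y ≠ 0 := fun h => hyz (Subtype.ext (sub_eq_zero.1 h).symm)
    have hsub : ((⟨y, hy⟩ : constructionA K) +ᵥ voronoi (constructionA K)) ∩
        ((⟨z, hz⟩ : constructionA K) +ᵥ voronoi (constructionA K)) ⊆
        (fun x => x - y) ⁻¹' {x | ‖x‖ = ‖x - (z - y)‖} := by
      rintro _ ⟨⟨u, hu, rfl⟩, ⟨v, hv, hvu⟩⟩
      change z + v = y + u at hvu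
      have hv' : v = u - (z - y) := by
        rw [eq_sub_of_add_eq' hvu]
        abel
      have h1 := hu _ (Submodule.sub_mem _ hz hy)
      have h2 := hv _ (Submodule.sub_mem _ hy hz)
      change ‖y + u - y‖ = ‖y + u - y - (z - y)‖
      rw [add_sub_cancel_left]
      refine le_antisymm h1 ?_
      rwa [hv', show u - (z - y) - (y - z) = u by abel] at h2
    refine measure_mono_null hsub ?_
    have := (measurePreserving_sub_right (volume : Measure (EuclideanSpace ℝ (Fin n))) y)
    rw [this.measure_preimage]
    · exact volume_bisector hne
    · exact (measurableSet_eq_fun (by fun_prop) (by fun_prop)).nullMeasurableSet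

/-- The half-open cube `[0, p)ⁿ`. -/
def box (n p : ℕ) : Set (EuclideanSpace ℝ (Fin n)) := {x | ∀ i, x i ∈ Set.Ico (0 : ℝ) p}

/-- The half-open unit cube with corner `a`. -/
def cell (a : Fin n → ℝ) : Set (EuclideanSpace ℝ (Fin n)) := {x | ∀ i, x i ∈ Set.Ico (a i) (a i + 1)}

theorem preimage_pi_Ico_eq (a b : Fin n → ℝ) :
    {x : EuclideanSpace ℝ (Fin n) | ∀ i, x i ∈ Set.Ico (a i) (b i)} =
      (WithLp.ofLp) ⁻¹' (Set.univ.pi fun i => Set.Ico (a i) (b i)) := by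
  ext x; simp

theorem measurableSet_pi_Ico (a b : Fin n → ℝ) :
    MeasurableSet {x : EuclideanSpace ℝ (Fin n) | ∀ i, x i ∈ Set.Ico (a i) (b i)} := by
  rw [preimage_pi_Ico_eq]
  exact (PiLp.volume_preserving_ofLp (Fin n)).measurable
    (MeasurableSet.univ_pi fun i => measurableSet_Ico)

theorem volume_pi_Ico (a b : Fin n → ℝ) :
    volume {x : EuclideanSpace ℝ (Fin n) | ∀ i, x i ∈ Set.Ico (a i) (b i)} =
      ∏ i, ENNReal.ofReal (b i - a i) := by
  rw [preimage_pi_Ico_eq, (PiLp.volume_preserving_ofLp (Fin n)).measure_preimage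
    (MeasurableSet.univ_pi fun i => measurableSet_Ico).nullMeasurableSet, Real.volume_pi_Ico]

theorem volume_box : volume (box n p) = (p : ENNReal) ^ n := by
  simpa [box] using volume_pi_Ico (fun _ : Fin n => (0 : ℝ)) (fun _ => (p : ℝ))

theorem volume_cell (a : Fin n → ℝ) : volume (cell a) = 1 := by
  simpa [cell] using volume_pi_Ico a (fun i => a i + 1)

theorem measurableSet_box : MeasurableSet (box n p) :=
  measurableSet_pi_Ico (fun _ => 0) (fun _ => p)

variable [Fact p.Prime]

/-- Every point of space has exactly `|K|` translates by the lattice of `K` in the cube. -/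
theorem tsum_indicator_box (K : Submodule (ZMod p) (Fin n → ZMod p))
    (x : EuclideanSpace ℝ (Fin n)) :
    ∑' g : constructionA K, (box n p).indicator (1 : EuclideanSpace ℝ (Fin n) → ENNReal) (g +ᵥ x) = Nat.card K := by
  have hp : (0 : ℤ) < p := by exact_mod_cast (Fact.out : p.Prime).pos
  have hcast : ∀ c (k : ZMod p), ((toIcoMod hp c (k.val : ℤ) : ℤ) : ZMod p) = k := by
    intro c k
    have h := toIcoMod_add_toIcoDiv_zsmul hp c (k.val : ℤ)
    have h2 := congrArg (fun t : ℤ => (t : ZMod p)) h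
    simpa using h2
  -- Coordinatewise, exactly one integer of a given residue class lies in the window of length `p`
  -- starting at `⌈-x i⌉`, and this is the condition that its sum with `x i` falls in `[0, p)`.
  let lift : K → constructionA K := fun k =>
    ⟨intPoint fun i => toIcoMod hp ⌈-x i⌉ ((k : Fin n → ZMod p) i).val, by
      rw [intPoint_mem_constructionA]
      simp only [hcast]
      exact k.2⟩
  have hmem : ∀ (z : ℤ) (t : ℝ), (z + t : ℝ) ∈ Set.Ico (0 : ℝ) p ↔
      z ∈ Set.Ico ⌈-t⌉ (⌈-t⌉ + (p : ℤ)) := by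
    intro z t
    simp only [Set.mem_Ico, Int.ceil_le]
    rw [← sub_lt_iff_lt_add, Int.lt_ceil]
    push_cast
    constructor <;> rintro ⟨h1, h2⟩ <;> constructor <;> linarith
  have hinj : Function.Injective lift := by
    intro k l h
    have h1 := intPoint_injective (congrArg Subtype.val h)
    ext i
    have h2 := congrArg (fun t : ℤ => (t : ZMod p)) (congrFun h1 i)
    simpa only [hcast] using h2
  have hval : ∀ k : K, (box n p).indicator (1 : EuclideanSpace ℝ (Fin n) → ENNReal) (lift k +ᵥ x) = 1 := by
    intro k
    refine Set.indicator_of_mem (s := box n p) (fun i => ?_) _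
    change ((toIcoMod hp ⌈-x i⌉ ((k : Fin n → ZMod p) i).val : ℤ) : ℝ) + x i ∈ _
    rw [hmem]
    exact toIcoMod_mem_Ico hp _ _
  rw [← hinj.tsum_eq]
  · simp only [hval, ENNReal.tsum_one]
    have : Finite K := inferInstance
    rw [ENat.card_eq_coe_natCard]
    simp
  · rintro ⟨g, hg⟩ hgx
    obtain ⟨z, rfl, hz⟩ := mem_constructionA.1 hg
    have hb : intPoint z + x ∈ box n p := by
      by_contra h
      exact hgx (Set.indicator_of_notMem h _)
    refine ⟨⟨_, hz⟩, Subtype.ext (congrArg intPoint (funext fun i => ?_))⟩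
    have h1 := (hmem (z i) (x i)).1 (hb i)
    refine Eq.trans ((toIcoMod_inj hp).2 ?_) ((toIcoMod_eq_self hp).2 h1)
    rw [AddCommGroup.modEq_iff_intModEq, ← ZMod.intCast_eq_intCast_iff]
    simp

/-- Unfolding: cut the cube by the translates of the Voronoi region and move each piece back by
periodicity; every point is then hit `|K|` times. -/
theorem card_mul_setLIntegral_voronoi (K : Submodule (ZMod p) (Fin n → ZMod p))
    {φ : EuclideanSpace ℝ (Fin n) → ENNReal} (hφ : Measurable φ)
    (hinv : ∀ y ∈ constructionA K, ∀ x, φ (y + x) = φ x) :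
    Nat.card K * ∫⁻ x in voronoi (constructionA K), φ x = ∫⁻ x in box n p, φ x := by
  rw [← lintegral_indicator measurableSet_box,
    (isAddFundamentalDomain_voronoi K).lintegral_eq_tsum'', ← lintegral_tsum, ← lintegral_const_mul']
  · congr 1
    funext x
    have : ∀ g : constructionA K, (box n p).indicator φ (g +ᵥ x) =
        (box n p).indicator (1 : EuclideanSpace ℝ (Fin n) → ENNReal) (g +ᵥ x) * φ x := by
      rintro ⟨g, hg⟩
      have h := hinv g hg x
      change (box n p).indicator φ (g + x) = (box n p).indicator (1 : EuclideanSpace ℝ (Fin n) → ENNReal) (g + x) * φ x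
      by_cases hb : g + x ∈ box n p <;> simp [hb, h]
    simp only [this]
    rw [ENNReal.tsum_mul_right, tsum_indicator_box]
  · exact ENNReal.natCast_ne_top _
  · intro g
    exact ((hφ.indicator measurableSet_box).comp (measurable_const_vadd g)).aemeasurable

end Geometry

/-! ### Bounds for the normalized second moment, from below always and from above by covering. -/

section SecondMoment

variable {n : ℕ}

/-- Among all sets of given volume, none has a normalized second moment below `1/(2πe)`. -/
theorem le_setIntegral_norm_sq (hn : 0 < n) {V : Set (EuclideanSpace ℝ (Fin n))}
    (hV : MeasurableSet V) (h0 : 0 < (volume V).toReal)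
    (hint : IntegrableOn (fun y => ‖y‖ ^ 2) V) :
    n * (volume V).toReal ^ (1 + 2 / (n : ℝ)) / (2 * Real.pi * Real.exp 1) ≤
      ∫ y in V, ‖y‖ ^ 2 := by
  set v := (volume V).toReal with hv
  have hn' : (0 : ℝ) < n := by exact_mod_cast hn
  have hpi := Real.pi_pos
  have hvtop : volume V ≠ ⊤ := fun h => by simp [hv, h] at h0
  -- The variance for which `exp(-‖y‖²/(2s))` has total mass `v e^(-n/2)`, so that the inequality is
  -- sharp to leading order for a ball.
  set s : ℝ := v ^ (2 / (n : ℝ)) / (2 * Real.pi * Real.exp 1) with hs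
  have hs0 : 0 < s := by positivity
  have hb : 0 < 1 / (2 * s) := by positivity
  have hG := GaussianFourier.integral_rexp_neg_mul_sq_norm (V := EuclideanSpace ℝ (Fin n)) hb
  have hval : (Real.pi / (1 / (2 * s))) ^ ((Module.finrank ℝ (EuclideanSpace ℝ (Fin n)) : ℝ) / 2) =
      v * Real.exp (-(n / 2)) := by
    have h1 : Real.pi / (1 / (2 * s)) = v ^ (2 / (n : ℝ)) * Real.exp (-1) := by
      rw [hs, Real.exp_neg]; field_simp
    rw [h1, finrank_euclideanSpace, Fintype.card_fin, Real.mul_rpow (by positivity) (by positivity),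
      ← Real.rpow_mul h0.le, ← Real.exp_mul]
    congr 1
    · rw [show 2 / (n : ℝ) * (n / 2) = 1 by field_simp, Real.rpow_one]
    · congr 1; ring
  rw [hval] at hG
  -- Without integrability the integral would be 0 by convention, yet its value is positive.
  have hgint : Integrable (fun y : EuclideanSpace ℝ (Fin n) => Real.exp (-(1 / (2 * s)) * ‖y‖ ^ 2)) := by
    by_contra h
    rw [integral_undef h] at hG
    have : 0 < v * Real.exp (-(n / 2)) := by positivity
    linarith
  -- Gibbs' inequality in the form `1 + x ≤ eˣ` at `x = n/2 - ‖y‖²/(2s)`; integrated over `V`, the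
  -- exponential costs at most `v` and leaves `v n/2`.
  have hpt : ∀ y : EuclideanSpace ℝ (Fin n),
      (1 + n / 2 : ℝ) - Real.exp (n / 2) * Real.exp (-(1 / (2 * s)) * ‖y‖ ^ 2) ≤
        1 / (2 * s) * ‖y‖ ^ 2 := by
    intro y
    rw [← Real.exp_add]
    have := Real.add_one_le_exp ((n : ℝ) / 2 + -(1 / (2 * s)) * ‖y‖ ^ 2)
    linarith
  have hI := setIntegral_mono_on (μ := volume) (s := V)
    ((integrableOn_const (C := (1 + n / 2 : ℝ)) hvtop).sub ((hgint.const_mul (Real.exp (n / 2))).integrableOn))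
    (hint.const_mul (1 / (2 * s))) hV (fun y _ => hpt y)
  rw [integral_const_mul] at hI
  simp only [Pi.sub_apply] at hI
  have hci : IntegrableOn (fun _ : EuclideanSpace ℝ (Fin n) => (1 + n / 2 : ℝ)) V :=
    integrableOn_const hvtop
  rw [integral_sub hci ((hgint.const_mul (Real.exp (n / 2))).integrableOn),
    setIntegral_const, integral_const_mul] at hI
  have hle : ∫ y in V, Real.exp (-(1 / (2 * s)) * ‖y‖ ^ 2) ≤ v * Real.exp (-(n / 2)) := by
    rw [← hG]
    exact setIntegral_le_integral hgint (ae_of_all _ fun y => (Real.exp_pos _).le)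
  have hvr : volume.real V = v := rfl
  rw [hvr, smul_eq_mul] at hI
  have h3 : Real.exp (n / 2) * ∫ y in V, Real.exp (-(1 / (2 * s)) * ‖y‖ ^ 2) ≤ v := by
    calc _ ≤ Real.exp (n / 2) * (v * Real.exp (-(n / 2))) :=
          mul_le_mul_of_nonneg_left hle (Real.exp_pos _).le
      _ = v := by rw [Real.exp_neg]; field_simp
  have h4 : v * (n / 2) ≤ 1 / (2 * s) * ∫ y in V, ‖y‖ ^ 2 := by linarith
  rw [div_mul_eq_mul_div, le_div_iff₀ (by positivity)] at h4
  calc n * v ^ (1 + 2 / (n : ℝ)) / (2 * Real.pi * Real.exp 1) = v * (n / 2) * (2 * s) := by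
        rw [hs, Real.rpow_add h0, Real.rpow_one]; ring
    _ ≤ _ := by linarith

theorem norm_eq_infDist_of_mem_voronoi {L : Submodule ℤ (EuclideanSpace ℝ (Fin n))}
    {x : EuclideanSpace ℝ (Fin n)} (hx : x ∈ voronoi L) :
    Metric.infDist x (L : Set (EuclideanSpace ℝ (Fin n))) = ‖x‖ := by
  refine le_antisymm ?_ ?_
  · simpa using Metric.infDist_le_dist_of_mem (x := x)
      (show (0 : EuclideanSpace ℝ (Fin n)) ∈ (L : Set _) from L.zero_mem)
  · refine (Metric.le_infDist ⟨0, L.zero_mem⟩).2 fun y hy => ?_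
    rw [dist_eq_norm]
    exact hx y hy

theorem infDist_add_left {L : Submodule ℤ (EuclideanSpace ℝ (Fin n))}
    {y : EuclideanSpace ℝ (Fin n)} (hy : y ∈ L) (x : EuclideanSpace ℝ (Fin n)) :
    Metric.infDist (y + x) (L : Set (EuclideanSpace ℝ (Fin n))) =
      Metric.infDist x (L : Set (EuclideanSpace ℝ (Fin n))) := by
  have key : ∀ y ∈ L, ∀ x, Metric.infDist (y + x) (L : Set (EuclideanSpace ℝ (Fin n))) ≤
      Metric.infDist x (L : Set (EuclideanSpace ℝ (Fin n))) := by
    intro y hy x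
    refine (Metric.le_infDist ⟨0, L.zero_mem⟩).2 fun z hz => ?_
    refine (Metric.infDist_le_dist_of_mem
      (show y + z ∈ (L : Set _) from L.add_mem hy hz)).trans ?_
    simp
  refine le_antisymm (key y hy x) ?_
  simpa using key (-y) (L.neg_mem hy) (y + x)

variable {p : ℕ} [Fact p.Prime]

theorem card_mul_volume_voronoi (K : Submodule (ZMod p) (Fin n → ZMod p)) :
    Nat.card K * volume (voronoi (constructionA K)) = (p : ENNReal) ^ n := by
  have h := card_mul_setLIntegral_voronoi K (φ := fun _ => 1) measurable_const (fun _ _ _ => rfl)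
  simpa [volume_box] using h

theorem card_mul_vol (K : Submodule (ZMod p) (Fin n → ZMod p)) :
    (Nat.card K : ℝ) * vol (constructionA K) = (p : ℝ) ^ n := by
  have h := congrArg ENNReal.toReal (card_mul_volume_voronoi K)
  simpa [vol] using h

theorem vol_pos (K : Submodule (ZMod p) (Fin n → ZMod p)) : 0 < vol (constructionA K) := by
  have hp : (0 : ℝ) < p := by exact_mod_cast (Fact.out : p.Prime).pos
  have h : 0 < (Nat.card K : ℝ) * vol (constructionA K) := by
    rw [card_mul_vol]; positivity
  exact pos_of_mul_pos_right h (Nat.cast_nonneg _)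

open Classical in
/-- The residue vectors that are not within (a lift of) distance `r` of the code `K`. -/
noncomputable def uncovered (K : Submodule (ZMod p) (Fin n → ZMod p)) (r : ℝ) : Finset (Fin n → ZMod p) :=
  Finset.univ.filter fun a =>
    ¬ ∃ u : Fin n → ℤ, ‖intPoint u‖ ≤ r ∧ (a + fun i => (u i : ZMod p)) ∈ K

/-- The unit cube whose corner is the standard lift of the residue vector `a`. -/
def residueCell (a : Fin n → ZMod p) : Set (EuclideanSpace ℝ (Fin n)) :=
  cell fun i => ((a i).val : ℝ)

theorem box_subset_iUnion : box n p ⊆ ⋃ a : Fin n → ZMod p, residueCell a := by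
  intro x hx
  refine Set.mem_iUnion.2 ⟨fun i => (⌊x i⌋₊ : ZMod p), fun i => ?_⟩
  have h1 : ⌊x i⌋₊ < p := (Nat.floor_lt (hx i).1).2 (hx i).2
  simp only [ZMod.val_natCast_of_lt h1]
  exact ⟨Nat.floor_le (hx i).1, Nat.lt_floor_add_one _⟩

theorem norm_le_sqrt_mul {x : EuclideanSpace ℝ (Fin n)} {c : ℝ} (hc : 0 ≤ c)
    (h : ∀ i, |x i| ≤ c) : ‖x‖ ≤ √n * c := by
  rw [EuclideanSpace.norm_eq]
  refine Real.sqrt_le_iff.2 ⟨by positivity, ?_⟩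
  rw [mul_pow, Real.sq_sqrt (Nat.cast_nonneg _)]
  calc ∑ i, ‖x i‖ ^ 2 ≤ ∑ _i : Fin n, c ^ 2 :=
        Finset.sum_le_sum fun i _ => pow_le_pow_left₀ (norm_nonneg _) (h i) 2
    _ = n * c ^ 2 := by simp

theorem infDist_le_of_mem_residueCell (K : Submodule (ZMod p) (Fin n → ZMod p))
    (a : Fin n → ZMod p) {x : EuclideanSpace ℝ (Fin n)} (hx : x ∈ residueCell a) :
    Metric.infDist x (constructionA K : Set (EuclideanSpace ℝ (Fin n))) ≤ √n * p := by
  refine (Metric.infDist_le_dist_of_mem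
    (show (0 : EuclideanSpace ℝ (Fin n)) ∈ (constructionA K : Set _) from
      Submodule.zero_mem _)).trans ?_
  rw [dist_zero_right]
  refine norm_le_sqrt_mul (Nat.cast_nonneg _) fun i => ?_
  obtain ⟨h1, h2⟩ := hx i
  have h3 : (((a i).val + 1 : ℕ) : ℝ) ≤ p := by exact_mod_cast (ZMod.val_lt (a i))
  push_cast at h3
  have h4 : (0 : ℝ) ≤ (a i).val := Nat.cast_nonneg _
  rw [abs_of_nonneg (by linarith)]
  linarith

/-- The corner of the cell is within `r` of the lattice, and a point of a unit cell is within `√n`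
of its corner. -/
theorem infDist_le_of_covered (K : Submodule (ZMod p) (Fin n → ZMod p)) {r : ℝ}
    {a : Fin n → ZMod p} (ha : a ∉ uncovered K r)
    {x : EuclideanSpace ℝ (Fin n)} (hx : x ∈ residueCell a) :
    Metric.infDist x (constructionA K : Set (EuclideanSpace ℝ (Fin n))) ≤ r + √n := by
  simp only [uncovered, Finset.mem_filter, Finset.mem_univ, true_and, not_not] at ha
  obtain ⟨u, hu, hK⟩ := ha
  have hmem : intPoint (fun i => ((a i).val : ℤ) + u i) ∈ constructionA K := by
    rw [intPoint_mem_constructionA]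
    convert hK using 1
    funext i
    simp
  refine (Metric.infDist_le_dist_of_mem hmem).trans ?_
  rw [dist_eq_norm]
  have : x - intPoint (fun i => ((a i).val : ℤ) + u i) =
      (x - intPoint fun i => ((a i).val : ℤ)) - intPoint u := by
    ext i; simp; ring
  rw [this]
  refine (norm_sub_le _ _).trans ?_
  have h1 : ‖x - intPoint fun i => ((a i).val : ℤ)‖ ≤ √n * 1 := by
    refine norm_le_sqrt_mul zero_le_one fun i => ?_
    obtain ⟨h1, h2⟩ := hx i
    simp only [PiLp.sub_apply, intPoint_apply, Int.cast_natCast]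
    rw [abs_le]
    constructor <;> linarith
  linarith

/-- On the Voronoi region `‖y‖` is the distance to the lattice, which is periodic. The integral
therefore moves to the cube, where it is estimated on `pⁿ` unit cells: `(r + √n)²` for each, and a
further `n p²` for those with uncovered corner. -/
theorem card_mul_setLIntegral_norm_sq_le (K : Submodule (ZMod p) (Fin n → ZMod p)) (r : ℝ) :
    Nat.card K * ∫⁻ y in voronoi (constructionA K), ENNReal.ofReal (‖y‖ ^ 2) ≤
      ENNReal.ofReal ((p : ℝ) ^ n * (r + √n) ^ 2 + (uncovered K r).card * (n * (p : ℝ) ^ 2)) := by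
  set φ : EuclideanSpace ℝ (Fin n) → ENNReal := fun x =>
    ENNReal.ofReal (Metric.infDist x (constructionA K : Set (EuclideanSpace ℝ (Fin n))) ^ 2) with hφ
  have hφm : Measurable φ :=
    ENNReal.measurable_ofReal.comp ((Metric.continuous_infDist_pt _).pow 2).measurable
  have h1 : ∫⁻ y in voronoi (constructionA K), ENNReal.ofReal (‖y‖ ^ 2) =
      ∫⁻ y in voronoi (constructionA K), φ y := by
    refine setLIntegral_congr_fun (voronoi_isClosed _).measurableSet fun y hy => ?_
    simp only [hφ, norm_eq_infDist_of_mem_voronoi hy]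
  rw [h1, card_mul_setLIntegral_voronoi K hφm fun y hy x => by simp only [hφ, infDist_add_left hy]]
  classical
  let b : (Fin n → ZMod p) → ℝ := fun a =>
    (r + √n) ^ 2 + if a ∈ uncovered K r then n * (p : ℝ) ^ 2 else 0
  have hb0 : ∀ a, 0 ≤ b a := fun a => by simp only [b]; split_ifs <;> positivity
  calc ∫⁻ x in box n p, φ x
      ≤ ∫⁻ x in ⋃ a : Fin n → ZMod p, residueCell a, φ x := lintegral_mono_set box_subset_iUnion
    _ ≤ ∑' a : Fin n → ZMod p, ∫⁻ x in residueCell a, φ x := lintegral_iUnion_le _ _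
    _ = ∑ a : Fin n → ZMod p, ∫⁻ x in residueCell a, φ x := tsum_fintype _
    _ ≤ ∑ a : Fin n → ZMod p, ENNReal.ofReal (b a) := by
        refine Finset.sum_le_sum fun a _ => ?_
        calc ∫⁻ x in residueCell a, φ x ≤ ∫⁻ _x in residueCell a, ENNReal.ofReal (b a) := by
              refine setLIntegral_mono measurable_const fun x hx => ENNReal.ofReal_le_ofReal ?_
              simp only [b]
              split_ifs with ha
              · have := pow_le_pow_left₀ Metric.infDist_nonneg (infDist_le_of_mem_residueCell K a hx) 2
                rw [mul_pow, Real.sq_sqrt (Nat.cast_nonneg _)] at this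
                nlinarith [sq_nonneg (r + √n)]
              · have := pow_le_pow_left₀ Metric.infDist_nonneg (infDist_le_of_covered K ha hx) 2
                linarith
          _ = ENNReal.ofReal (b a) := by
              rw [setLIntegral_const, residueCell, volume_cell, mul_one]
    _ = ENNReal.ofReal (∑ a, b a) := (ENNReal.ofReal_sum_of_nonneg fun a _ => hb0 a).symm
    _ = _ := by
        congr 1
        simp only [b, Finset.sum_add_distrib, Finset.sum_ite_mem, Finset.univ_inter]
        simp [ZMod.card]

/-- The cellwise bound is finite for any radius; 0 is an arbitrary choice. -/
theorem integrableOn_norm_sq_voronoi (K : Submodule (ZMod p) (Fin n → ZMod p)) :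
    IntegrableOn (fun y => ‖y‖ ^ 2) (voronoi (constructionA K)) := by
  refine ⟨by fun_prop, ?_⟩
  rw [hasFiniteIntegral_iff_ofReal (ae_of_all _ fun y => by positivity)]
  have h := (card_mul_setLIntegral_norm_sq_le K 0).trans_lt ENNReal.ofReal_lt_top
  have hK : (Nat.card K : ENNReal) ≠ 0 := by
    have : 0 < Nat.card K := Nat.card_pos
    exact_mod_cast this.ne'
  exact (ENNReal.mul_lt_top_iff.1 h).elim (fun h => h.2)
    (fun h => h.elim (fun h => absurd h hK) (fun h => by rw [h]; exact ENNReal.zero_lt_top))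

theorem card_mul_setIntegral_norm_sq_le (K : Submodule (ZMod p) (Fin n → ZMod p)) (r : ℝ) :
    Nat.card K * ∫ y in voronoi (constructionA K), ‖y‖ ^ 2 ≤
      (p : ℝ) ^ n * (r + √n) ^ 2 + (uncovered K r).card * (n * (p : ℝ) ^ 2) := by
  have h := ENNReal.toReal_mono ENNReal.ofReal_ne_top (card_mul_setLIntegral_norm_sq_le K r)
  rw [ENNReal.toReal_ofReal (by positivity), ENNReal.toReal_mul,
    ← integral_eq_lintegral_of_nonneg_ae (ae_of_all _ fun y => by positivity) (by fun_prop)] at h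
  simpa using h

theorem le_secondMoment (hn : 0 < n) (K : Submodule (ZMod p) (Fin n → ZMod p)) :
    1 / (2 * Real.pi * Real.exp 1) ≤ secondMoment (constructionA K) := by
  have h := le_setIntegral_norm_sq hn (voronoi_isClosed (constructionA K)).measurableSet
    (vol_pos K) (integrableOn_norm_sq_voronoi K)
  have hv := vol_pos K
  have hn' : (0 : ℝ) < n := by exact_mod_cast hn
  rw [secondMoment, one_div_mul_eq_div, le_div_iff₀ (by positivity)]
  change n * vol (constructionA K) ^ (1 + 2 / (n : ℝ)) / _ ≤ _ at h
  rwa [one_div_mul_eq_div]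

/-- If the code has the generic number `pⁿ⁻ᵐ` of words, then the normalized second moment is
controlled by the proportion of residue vectors that are not covered by balls of radius `r`. -/
theorem secondMoment_le (hn : 0 < n) {K : Submodule (ZMod p) (Fin n → ZMod p)} {m : ℕ}
    (hK : Nat.card K * p ^ m = p ^ n) (r : ℝ) :
    secondMoment (constructionA K) ≤
      ((r + √n) ^ 2 / n + (uncovered K r).card / (p : ℝ) ^ n * (p : ℝ) ^ 2) /
        (p : ℝ) ^ (2 * (m : ℝ) / n) := by
  have hn' : (0 : ℝ) < n := by exact_mod_cast hn
  have hp : (0 : ℝ) < p := by exact_mod_cast (Fact.out : p.Prime).pos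
  have hK' : (Nat.card K : ℝ) * (p : ℝ) ^ m = (p : ℝ) ^ n := by exact_mod_cast hK
  have hK0 : (0 : ℝ) < Nat.card K := by exact_mod_cast Nat.card_pos
  have hvol : vol (constructionA K) = (p : ℝ) ^ m := by
    have := card_mul_vol K
    rw [← hK'] at this
    exact mul_left_cancel₀ hK0.ne' this
  have hpow : vol (constructionA K) ^ (1 + 2 / (n : ℝ)) =
      (p : ℝ) ^ m * (p : ℝ) ^ (2 * (m : ℝ) / n) := by
    rw [Real.rpow_add (vol_pos K), Real.rpow_one, hvol, ← Real.rpow_natCast, ← Real.rpow_mul hp.le]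
    congr 2; ring
  have h := card_mul_setIntegral_norm_sq_le K r
  rw [secondMoment, hpow, one_div_mul_eq_div, div_le_div_iff₀ (by positivity) (by positivity)]
  have h2 : ∫ y in voronoi (constructionA K), ‖y‖ ^ 2 ≤
      ((p : ℝ) ^ n * (r + √n) ^ 2 + (uncovered K r).card * (n * (p : ℝ) ^ 2)) / Nat.card K := by
    rwa [le_div_iff₀ hK0, mul_comm]
  have h3 : ((p : ℝ) ^ n * (r + √n) ^ 2 + (uncovered K r).card * (n * (p : ℝ) ^ 2)) / Nat.card K =
      ((r + √n) ^ 2 / n + (uncovered K r).card / (p : ℝ) ^ n * (p : ℝ) ^ 2) * (n * (p : ℝ) ^ m) := by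
    rw [← hK']; field_simp
  rw [h3] at h2
  calc _ ≤ _ := mul_le_mul_of_nonneg_right h2 (by positivity)
    _ = _ := by ring

end SecondMoment

/-! ### Averages over the random coefficients and the union bound over silent checks. -/

section Averages

variable {n m p : ℕ} [Fact p.Prime]

/-- The code with parity check matrix `Ĥ ⊙ h'`. -/
noncomputable def codeOf (g : BipGraph (Fin n) (Fin m)) (h' : Fin m → Fin n → ZMod p) :
    Submodule (ZMod p) (Fin n → ZMod p) :=
  LinearMap.ker (Matrix.mulVecLin (Matrix.hadamard (g.skeleton p) (Matrix.of h')))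

open Classical in
/-- The check nodes all of whose neighbours carry a zero of `v`. -/
noncomputable def silentChecks (g : BipGraph (Fin n) (Fin m)) (v : Fin n → ZMod p) :
    Finset (Fin m) :=
  Finset.univ.filter fun c => ∀ j, g.Adj j c → v j = 0

-- For `c ≠ 0` the solution set is the kernel of a nonzero functional, of codimension 1. Multiplying
-- by `p` keeps the count free of subtraction.
open Classical in
theorem card_filter_dotProduct_eq_zero (c : Fin n → ZMod p) :
    (Finset.univ.filter fun x : Fin n → ZMod p => ∑ j, c j * x j = 0).card * p =
      p ^ n * if c = 0 then p else 1 := by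
  split_ifs with hc
  · subst hc
    simp [ZMod.card]
  · let f : Module.Dual (ZMod p) (Fin n → ZMod p) := ∑ j, c j • LinearMap.proj j
    have hf : ∀ x, f x = ∑ j, c j * x j := fun x => by simp [f]
    have hf0 : f ≠ 0 := by
      intro h
      apply hc
      funext j
      have := LinearMap.congr_fun h (Pi.single j 1)
      simpa [hf, Pi.single_apply] using this
    have h1 := Module.Dual.finrank_ker_add_one_of_ne_zero hf0
    rw [Module.finrank_fin_fun] at h1
    have h2 : (Finset.univ.filter fun x : Fin n → ZMod p => ∑ j, c j * x j = 0).card =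
        Nat.card (LinearMap.ker f) := by
      rw [Nat.card_eq_fintype_card, Fintype.card_subtype]
      congr 1
      ext x
      simp [hf]
    rw [h2, Module.natCard_eq_pow_finrank (K := ZMod p), Nat.card_zmod, ← pow_succ, h1, mul_one]

theorem mem_codeOf {g : BipGraph (Fin n) (Fin m)} {h' : Fin m → Fin n → ZMod p}
    {v : Fin n → ZMod p} :
    v ∈ codeOf g h' ↔ ∀ i, ∑ j, (g.skeleton p i j * v j) * h' i j = 0 := by
  rw [codeOf, LinearMap.mem_ker, Matrix.mulVecLin_apply, funext_iff]
  refine forall_congr' fun i => ?_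
  simp only [Matrix.mulVec, dotProduct, Matrix.hadamard_apply, Matrix.of_apply, Pi.zero_apply]
  refine Eq.congr (Finset.sum_congr rfl fun j _ => by ring) rfl

open Classical in
/-- The number of coefficient matrices for which `v` is a codeword. -/
theorem card_filter_mem_codeOf (g : BipGraph (Fin n) (Fin m)) (v : Fin n → ZMod p) :
    (Finset.univ.filter fun h' : Fin m → Fin n → ZMod p => v ∈ codeOf g h').card * p ^ m =
      Fintype.card (Fin m → Fin n → ZMod p) * p ^ (silentChecks g v).card := by
  -- Each check constrains only its own row of coefficients, so the count is a product over rows; a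
  -- row is unconstrained exactly when its check is silent.
  have h1 : (Finset.univ.filter fun h' : Fin m → Fin n → ZMod p => v ∈ codeOf g h') =
      Fintype.piFinset fun i => Finset.univ.filter fun x : Fin n → ZMod p =>
        ∑ j, (g.skeleton p i j * v j) * x j = 0 := by
    ext h'
    simp [mem_codeOf, Fintype.mem_piFinset]
  have h2 : ∀ i, (fun j => g.skeleton p i j * v j) = 0 ↔ i ∈ silentChecks g v := by
    intro i
    simp only [funext_iff, silentChecks, Finset.mem_filter, Finset.mem_univ, true_and,
      BipGraph.skeleton, Matrix.of_apply, Pi.zero_apply]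
    refine forall_congr' fun j => ?_
    split_ifs with h <;> simp [h]
  rw [h1, Fintype.card_piFinset]
  calc _ = ∏ i : Fin m, ((Finset.univ.filter fun x : Fin n → ZMod p =>
        ∑ j, (g.skeleton p i j * v j) * x j = 0).card * p) := by
        rw [Finset.prod_mul_distrib]; simp
    _ = ∏ i : Fin m, (p ^ n * if i ∈ silentChecks g v then p else 1) := by
        refine Finset.prod_congr rfl fun i _ => ?_
        rw [card_filter_dotProduct_eq_zero]
        simp only [h2]
    _ = _ := by
        rw [Finset.prod_mul_distrib, Finset.prod_ite_mem]
        simp [ZMod.card]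

/-- The average of `f` over all coefficient matrices. -/
noncomputable def avg (f : (Fin m → Fin n → ZMod p) → ℝ) : ℝ :=
  (∑ h', f h') / Fintype.card (Fin m → Fin n → ZMod p)

theorem card_matrices_pos : (0 : ℝ) < Fintype.card (Fin m → Fin n → ZMod p) := by
  exact_mod_cast Fintype.card_pos

theorem avg_nonneg {f : (Fin m → Fin n → ZMod p) → ℝ} (h : ∀ x, 0 ≤ f x) : 0 ≤ avg f :=
  div_nonneg (Finset.sum_nonneg fun x _ => h x) (Nat.cast_nonneg _)

theorem avg_mono {f f' : (Fin m → Fin n → ZMod p) → ℝ} (h : ∀ x, f x ≤ f' x) : avg f ≤ avg f' :=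
  div_le_div_of_nonneg_right (Finset.sum_le_sum fun x _ => h x) card_matrices_pos.le

open Classical in
theorem pow_mul_avg_mem_codeOf (g : BipGraph (Fin n) (Fin m)) (v : Fin n → ZMod p) :
    (p : ℝ) ^ m * avg (fun h' : Fin m → Fin n → ZMod p => if v ∈ codeOf g h' then (1 : ℝ) else 0) =
      (p : ℝ) ^ (silentChecks g v).card := by
  rw [avg, Finset.sum_boole, mul_div_assoc', div_eq_iff card_matrices_pos.ne', mul_comm,
    mul_comm ((p : ℝ) ^ _)]
  exact_mod_cast card_filter_mem_codeOf g v

theorem avg_sum {ι : Type*} (s : Finset ι) (f : ι → (Fin m → Fin n → ZMod p) → ℝ) :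
    avg (fun x => ∑ i ∈ s, f i x) = ∑ i ∈ s, avg (f i) := by
  simp only [avg]
  rw [Finset.sum_comm, Finset.sum_div]

theorem avg_const_mul (c : ℝ) (f : (Fin m → Fin n → ZMod p) → ℝ) :
    avg (fun x => c * f x) = c * avg f := by
  simp only [avg, ← Finset.mul_sum, mul_div_assoc]

theorem avg_sub_const (c : ℝ) (f : (Fin m → Fin n → ZMod p) → ℝ) :
    avg (fun x => f x - c) = avg f - c := by
  simp only [avg, Finset.sum_sub_distrib, sub_div]
  congr 1
  rw [Finset.sum_const, nsmul_eq_mul, Finset.card_univ]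
  field_simp [card_matrices_pos.ne']

-- The single term `T = silentChecks g v` already suffices. The sum over all `T` replaces a power
-- depending on `v` by indicators of fixed events, whose averages over `v` are accessible.
open Classical in
theorem pow_card_silentChecks_le (g : BipGraph (Fin n) (Fin m)) (v : Fin n → ZMod p) :
    (p : ℝ) ^ (silentChecks g v).card - 1 ≤
      ∑ T : Finset (Fin m) with T.Nonempty,
        (p : ℝ) ^ T.card * if ∀ j ∈ g.nbrOfRight T, v j = 0 then 1 else 0 := by
  have hnn : ∀ T ∈ (Finset.univ.filter fun T : Finset (Fin m) => T.Nonempty),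
      0 ≤ (p : ℝ) ^ T.card * if ∀ j ∈ g.nbrOfRight T, v j = 0 then (1 : ℝ) else 0 := by
    intro T _; positivity
  rcases (silentChecks g v).eq_empty_or_nonempty with h | h
  · rw [h]
    simpa using Finset.sum_nonneg hnn
  · have h1 : ∀ j ∈ g.nbrOfRight (silentChecks g v), v j = 0 := by
      intro j hj
      simp only [BipGraph.nbrOfRight, silentChecks, Finset.mem_filter, Finset.mem_univ,
        true_and] at hj
      obtain ⟨c, hc, hjc⟩ := hj
      exact hc j hjc
    have := Finset.single_le_sum hnn (a := silentChecks g v) (by simpa using h)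
    rw [if_pos h1] at this
    linarith

-- Once `a + u` is a codeword, `a + v` is one precisely when `u - v` is, and `a ↦ a + u` is a
-- bijection of the ambient space.
open Classical in
theorem card_filter_mem_and_mem (K : Submodule (ZMod p) (Fin n → ZMod p)) (u v : Fin n → ZMod p) :
    ((Finset.univ.filter fun a : Fin n → ZMod p => a + u ∈ K ∧ a + v ∈ K).card : ℝ) =
      Nat.card K * if u - v ∈ K then 1 else 0 := by
  have hcard : (Finset.univ.filter fun a : Fin n → ZMod p => a + u ∈ K).card = Nat.card K := by
    rw [Nat.card_eq_fintype_card, Fintype.card_subtype]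
    refine Finset.card_bij (fun a _ => a + u) (fun a ha => by simpa using ha)
      (fun a _ b _ h => by simpa using h) fun b hb => ⟨b - u, by simpa using hb, by simp⟩
  split_ifs with h
  · rw [mul_one, ← hcard]
    congr 2
    ext a
    simp only [Finset.mem_filter, Finset.mem_univ, true_and, and_iff_left_iff_imp]
    intro ha
    have := K.sub_mem ha h
    convert this using 1
    abel
  · rw [mul_zero, Nat.cast_eq_zero, Finset.card_eq_zero, Finset.filter_eq_empty_iff]
    rintro a - ⟨h1, h2⟩
    apply h
    have := K.sub_mem h1 h2
    convert this using 1
    abel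

open Classical in
/-- Chebyshev's inequality for the weighted number of codewords near a random residue vector. -/
theorem card_uncovered_div_le (K : Submodule (ZMod p) (Fin n → ZMod p)) {r : ℝ}
    (U : Finset (Fin n → ℤ)) (W : (Fin n → ℤ) → ℝ) (hU : ∀ u ∈ U, ‖intPoint u‖ ≤ r)
    (hM : 0 < ∑ u ∈ U, W u) :
    ((uncovered K r).card : ℝ) / (p : ℝ) ^ n ≤
      (p : ℝ) ^ n / Nat.card K * ((∑ u ∈ U, ∑ u' ∈ U, W u * W u' *
        if (fun i => (u i : ZMod p)) - (fun i => (u' i : ZMod p)) ∈ K then 1 else 0) /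
          (∑ u ∈ U, W u) ^ 2) - 1 := by
  set M := ∑ u ∈ U, W u with hMdef
  have hp : (0 : ℝ) < p := by exact_mod_cast (Fact.out : p.Prime).pos
  set q : ℝ := (p : ℝ) ^ n with hq
  have hq0 : 0 < q := by positivity
  set k : ℝ := (Nat.card K : ℝ) with hk
  have hk0 : 0 < k := by rw [hk]; exact_mod_cast Nat.card_pos
  let red : (Fin n → ℤ) → (Fin n → ZMod p) := fun u i => (u i : ZMod p)
  let N : (Fin n → ZMod p) → ℝ := fun a => ∑ u ∈ U, W u * if a + red u ∈ K then 1 else 0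
  have hcount : ∀ u v : Fin n → ℤ, ∑ a : Fin n → ZMod p,
      ((if a + red u ∈ K then (1 : ℝ) else 0) * if a + red v ∈ K then 1 else 0) =
      k * if red u - red v ∈ K then 1 else 0 := by
    intro u v
    rw [← card_filter_mem_and_mem, ← Finset.sum_boole]
    refine Finset.sum_congr rfl fun a _ => ?_
    by_cases h1 : a + red u ∈ K <;> by_cases h2 : a + red v ∈ K <;> simp [h1, h2]
  have hS1 : ∑ a, N a = M * k := by
    simp only [N]
    rw [Finset.sum_comm, hMdef, Finset.sum_mul]
    refine Finset.sum_congr rfl fun u _ => ?_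
    rw [← Finset.mul_sum]
    congr 1
    have := hcount u u
    simp only [sub_self, K.zero_mem, if_true, mul_one] at this
    rw [← this]
    refine Finset.sum_congr rfl fun a _ => ?_
    split_ifs <;> simp
  set S := ∑ u ∈ U, ∑ u' ∈ U, W u * W u' * (if red u - red u' ∈ K then (1 : ℝ) else 0) with hS
  have hS2 : ∑ a, N a ^ 2 = k * S := by
    simp only [N, sq, Finset.sum_mul_sum]
    rw [Finset.sum_comm, hS, Finset.mul_sum]
    refine Finset.sum_congr rfl fun u _ => ?_
    rw [Finset.sum_comm, Finset.mul_sum]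
    refine Finset.sum_congr rfl fun u' _ => ?_
    rw [show k * (W u * W u' * (if red u - red u' ∈ K then (1 : ℝ) else 0)) =
      W u * W u' * (k * if red u - red u' ∈ K then (1 : ℝ) else 0) by ring, ← hcount,
      Finset.mul_sum]
    exact Finset.sum_congr rfl fun a _ => by ring
  have hcardG : ((Finset.univ : Finset (Fin n → ZMod p)).card : ℝ) = q := by
    simp [ZMod.card, hq]
  -- `M k / q` is the mean of `N` over all residue vectors.
  have hvar : ∑ a, (N a - M * k / q) ^ 2 = k * S - M ^ 2 * k ^ 2 / q := by
    simp only [sub_sq, Finset.sum_add_distrib, Finset.sum_sub_distrib, hS2, ← Finset.sum_mul,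
      ← Finset.mul_sum, hS1, Finset.sum_const, nsmul_eq_mul, hcardG]
    field_simp
    ring
  -- An uncovered vector sees no codeword, so there `N` deviates from its mean by the whole mean.
  have hunc : ∀ a ∈ uncovered K r, N a = 0 := by
    intro a ha
    simp only [uncovered, Finset.mem_filter, Finset.mem_univ, true_and, not_exists, not_and] at ha
    refine Finset.sum_eq_zero fun u hu => ?_
    rw [if_neg (ha u (hU u hu)), mul_zero]
  have hle : ((uncovered K r).card : ℝ) * (M * k / q) ^ 2 ≤ k * S - M ^ 2 * k ^ 2 / q := by
    rw [← hvar, ← nsmul_eq_mul, ← Finset.sum_const]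
    calc _ = ∑ a ∈ uncovered K r, (N a - M * k / q) ^ 2 :=
          Finset.sum_congr rfl fun a ha => by rw [hunc a ha]; ring
      _ ≤ _ := Finset.sum_le_sum_of_subset_of_nonneg (Finset.subset_univ _) fun _ _ _ => sq_nonneg _
  have hfin : ((uncovered K r).card : ℝ) / q = ((uncovered K r).card : ℝ) * (M * k / q) ^ 2 *
      (q / (M ^ 2 * k ^ 2)) := by
    field_simp
  rw [hfin]
  refine (mul_le_mul_of_nonneg_right hle (by positivity)).trans (le_of_eq ?_)
  field_simp

/-- The `m` checks lower the dimension by at most `m`, with equality when they are independent. -/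
theorem pow_le_card_mul_pow (g : BipGraph (Fin n) (Fin m)) (h' : Fin m → Fin n → ZMod p) :
    p ^ n ≤ Nat.card (codeOf g h') * p ^ m := by
  have hp := (Fact.out : p.Prime).pos
  have h1 := LinearMap.finrank_range_add_finrank_ker
    (Matrix.mulVecLin (Matrix.hadamard (g.skeleton p) (Matrix.of h')))
  rw [Module.finrank_fin_fun] at h1
  have h2 := Submodule.finrank_le
    (LinearMap.range (Matrix.mulVecLin (Matrix.hadamard (g.skeleton p) (Matrix.of h'))))
  rw [Module.finrank_fin_fun] at h2
  rw [Module.natCard_eq_pow_finrank (K := ZMod p), Nat.card_zmod, ← pow_add, codeOf]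
  exact Nat.pow_le_pow_right hp (by omega)

open Classical in
/-- The probability that two independent random integer vectors with (unnormalized) law `W`
agree modulo `p` on the coordinates in `Z`. -/
noncomputable def collision (p : ℕ) (U : Finset (Fin n → ℤ)) (W : (Fin n → ℤ) → ℝ)
    (Z : Finset (Fin n)) : ℝ :=
  (∑ u ∈ U, ∑ u' ∈ U, W u * W u' *
    if ∀ j ∈ Z, (u j : ZMod p) = (u' j : ZMod p) then 1 else 0) / (∑ u ∈ U, W u) ^ 2

-- Chebyshev's bound for each code, with `pⁿ/|K|` replaced by the larger `p^m`. The average of `p^m`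
-- times the indicator of `u - u' ∈ K` is then `p` to the number of silent checks, and the `-1` is
-- distributed over the pairs, whose normalized weights sum to 1.
open Classical in
theorem avg_card_uncovered_le (g : BipGraph (Fin n) (Fin m)) {r : ℝ}
    (U : Finset (Fin n → ℤ)) (W : (Fin n → ℤ) → ℝ) (hU : ∀ u ∈ U, ‖intPoint u‖ ≤ r)
    (hW : ∀ u ∈ U, 0 ≤ W u) (hM : 0 < ∑ u ∈ U, W u) :
    avg (fun h' : Fin m → Fin n → ZMod p => ((uncovered (codeOf g h') r).card : ℝ) / (p : ℝ) ^ n) ≤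
      ∑ T : Finset (Fin m) with T.Nonempty,
        (p : ℝ) ^ T.card * collision p U W (g.nbrOfRight T) := by
  have hp : (0 : ℝ) < p := by exact_mod_cast (Fact.out : p.Prime).pos
  set M := ∑ u ∈ U, W u with hMdef
  let red : (Fin n → ℤ) → (Fin n → ZMod p) := fun u i => (u i : ZMod p)
  have step1 : ∀ h' : Fin m → Fin n → ZMod p,
      ((uncovered (codeOf g h') r).card : ℝ) / (p : ℝ) ^ n ≤
      (∑ u ∈ U, ∑ u' ∈ U, W u * W u' / M ^ 2 * ((p : ℝ) ^ m *
        if red u - red u' ∈ codeOf g h' then 1 else 0)) - 1 := by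
    intro h'
    refine (card_uncovered_div_le _ U W hU hM).trans ?_
    have hK0 : (0 : ℝ) < Nat.card (codeOf g h') := by exact_mod_cast Nat.card_pos
    have h1 : (p : ℝ) ^ n / Nat.card (codeOf g h') ≤ (p : ℝ) ^ m := by
      rw [div_le_iff₀ hK0, mul_comm]
      exact_mod_cast pow_le_card_mul_pow g h'
    have h2 : 0 ≤ (∑ u ∈ U, ∑ u' ∈ U, W u * W u' *
        if red u - red u' ∈ codeOf g h' then (1 : ℝ) else 0) / M ^ 2 := by
      refine div_nonneg (Finset.sum_nonneg fun u hu => Finset.sum_nonneg fun u' hu' => ?_)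
        (sq_nonneg _)
      exact mul_nonneg (mul_nonneg (hW u hu) (hW u' hu')) (by split_ifs <;> norm_num)
    have h3 := mul_le_mul_of_nonneg_right h1 h2
    refine (sub_le_sub_right h3 1).trans (le_of_eq ?_)
    congr 1
    rw [Finset.sum_div, Finset.mul_sum]
    refine Finset.sum_congr rfl fun u _ => ?_
    rw [Finset.sum_div, Finset.mul_sum]
    exact Finset.sum_congr rfl fun u' _ => by ring
  refine (avg_mono step1).trans ?_
  rw [avg_sub_const, avg_sum]
  have step2 : ∀ u u', avg (fun h' : Fin m → Fin n → ZMod p => W u * W u' / M ^ 2 * ((p : ℝ) ^ m *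
        if red u - red u' ∈ codeOf g h' then 1 else 0)) =
      W u * W u' / M ^ 2 * (p : ℝ) ^ (silentChecks g (red u - red u')).card := by
    intro u u'
    rw [avg_const_mul, avg_const_mul, pow_mul_avg_mem_codeOf]
  have hone : (1 : ℝ) = ∑ u ∈ U, ∑ u' ∈ U, W u * W u' / M ^ 2 := by
    simp only [← Finset.sum_div, ← Finset.sum_mul_sum]
    rw [← hMdef]
    field_simp
  calc _ = ∑ u ∈ U, ∑ u' ∈ U, W u * W u' / M ^ 2 *
        ((p : ℝ) ^ (silentChecks g (red u - red u')).card - 1) := by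
        refine (congrArg₂ (· - ·) rfl hone).trans ?_
        rw [← Finset.sum_sub_distrib]
        refine Finset.sum_congr rfl fun u _ => ?_
        rw [avg_sum, ← Finset.sum_sub_distrib]
        refine Finset.sum_congr rfl fun u' _ => ?_
        rw [step2]
        ring
    _ ≤ ∑ u ∈ U, ∑ u' ∈ U, W u * W u' / M ^ 2 * ∑ T : Finset (Fin m) with T.Nonempty,
        (p : ℝ) ^ T.card * if ∀ j ∈ g.nbrOfRight T, (red u - red u') j = 0 then 1 else 0 := by
        refine Finset.sum_le_sum fun u hu => Finset.sum_le_sum fun u' hu' => ?_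
        refine mul_le_mul_of_nonneg_left (pow_card_silentChecks_le g _) ?_
        exact div_nonneg (mul_nonneg (hW u hu) (hW u' hu')) (sq_nonneg _)
    _ = _ := by
        simp only [Finset.mul_sum]
        rw [Finset.sum_congr rfl fun u _ => Finset.sum_comm, Finset.sum_comm]
        refine Finset.sum_congr rfl fun T _ => ?_
        rw [collision, Finset.sum_div, Finset.mul_sum]
        refine Finset.sum_congr rfl fun u _ => ?_
        rw [Finset.sum_div, Finset.mul_sum]
        refine Finset.sum_congr rfl fun u' _ => ?_
        simp only [red, Pi.sub_apply, sub_eq_zero]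
        ring

open Classical in
theorem card_filter_forall_mem_eq_zero (Z : Finset (Fin n)) :
    (Finset.univ.filter fun v : Fin n → ZMod p => ∀ j ∈ Z, v j = 0).card * p ^ Z.card = p ^ n := by
  have h1 : (Finset.univ.filter fun v : Fin n → ZMod p => ∀ j ∈ Z, v j = 0) =
      Fintype.piFinset fun j => if j ∈ Z then {0} else Finset.univ := by
    ext v
    simp only [Finset.mem_filter, Finset.mem_univ, true_and, Fintype.mem_piFinset]
    refine forall_congr' fun j => ?_
    split_ifs with h <;> simp [h]
  have h2 : ∀ j, (if j ∈ Z then ({0} : Finset (ZMod p)) else Finset.univ).card *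
      (if j ∈ Z then p else 1) = p := by
    intro j
    split_ifs <;> simp [ZMod.card]
  have h3 : p ^ Z.card = ∏ j : Fin n, if j ∈ Z then p else 1 := by
    rw [Finset.prod_ite_mem]
    simp
  rw [h1, Fintype.card_piFinset, h3, ← Finset.prod_mul_distrib]
  simp [h2]

-- The expected excess in the number of codewords over the generic `p^(n-m)`. The union bound is
-- applied to a uniform vector, which vanishes on `Z` with probability `p^(-|Z|)`.
open Classical in
theorem avg_card_codeOf_le (g : BipGraph (Fin n) (Fin m)) :
    avg (fun h' : Fin m → Fin n → ZMod p =>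
        (Nat.card (codeOf g h') : ℝ) * (p : ℝ) ^ m / (p : ℝ) ^ n - 1) ≤
      ∑ T : Finset (Fin m) with T.Nonempty,
        (p : ℝ) ^ T.card / (p : ℝ) ^ (g.nbrOfRight T).card := by
  have hp : (0 : ℝ) < p := by exact_mod_cast (Fact.out : p.Prime).pos
  have hcard : ∀ h' : Fin m → Fin n → ZMod p,
      (Nat.card (codeOf g h') : ℝ) * (p : ℝ) ^ m / (p : ℝ) ^ n =
      ∑ v : Fin n → ZMod p, 1 / (p : ℝ) ^ n * ((p : ℝ) ^ m * if v ∈ codeOf g h' then 1 else 0) := by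
    intro h'
    rw [← Finset.mul_sum, ← Finset.mul_sum, Finset.sum_boole, Nat.card_eq_fintype_card,
      Fintype.card_subtype]
    ring
  have hone : (1 : ℝ) = ∑ _v : Fin n → ZMod p, 1 / (p : ℝ) ^ n := by
    simp [ZMod.card]
  rw [avg_sub_const]
  simp only [hcard]
  rw [avg_sum]
  simp only [avg_const_mul, pow_mul_avg_mem_codeOf]
  calc _ = ∑ v : Fin n → ZMod p, 1 / (p : ℝ) ^ n * ((p : ℝ) ^ (silentChecks g v).card - 1) := by
        refine (congrArg₂ (· - ·) rfl hone).trans ?_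
        rw [← Finset.sum_sub_distrib]
        exact Finset.sum_congr rfl fun v _ => by ring
    _ ≤ ∑ v : Fin n → ZMod p, 1 / (p : ℝ) ^ n * ∑ T : Finset (Fin m) with T.Nonempty,
        (p : ℝ) ^ T.card * if ∀ j ∈ g.nbrOfRight T, v j = 0 then 1 else 0 :=
        Finset.sum_le_sum fun v _ =>
          mul_le_mul_of_nonneg_left (pow_card_silentChecks_le g v) (by positivity)
    _ = _ := by
        rw [← Finset.mul_sum, Finset.sum_comm, Finset.mul_sum]
        refine Finset.sum_congr rfl fun T _ => ?_
        rw [← Finset.mul_sum, Finset.sum_boole]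
        have := card_filter_forall_mem_eq_zero (p := p) (g.nbrOfRight T)
        have h : ((Finset.univ.filter fun v : Fin n → ZMod p =>
            ∀ j ∈ g.nbrOfRight T, v j = 0).card : ℝ) * (p : ℝ) ^ (g.nbrOfRight T).card =
            (p : ℝ) ^ n := by exact_mod_cast this
        rw [← h]
        have hpos : (0 : ℝ) < (Finset.univ.filter fun v : Fin n → ZMod p =>
            ∀ j ∈ g.nbrOfRight T, v j = 0).card := by
          refine pos_of_mul_pos_left (b := (p : ℝ) ^ (g.nbrOfRight T).card) ?_ (by positivity)
          rw [h]; positivity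
        generalize ((Finset.univ.filter fun v : Fin n → ZMod p =>
            ∀ j ∈ g.nbrOfRight T, v j = 0).card : ℝ) = c at hpos ⊢
        field_simp

end Averages

/-! ### One-dimensional Gaussian sums and their asymptotics. -/

section Theta

/-- The truncated theta series `∑_{|k| ≤ N} exp (-a k²)`. -/
noncomputable def theta (N : ℕ) (a : ℝ) : ℝ :=
  ∑ k ∈ Finset.Icc (-(N : ℤ)) N, Real.exp (-a * (k : ℝ) ^ 2)

theorem theta_succ (N : ℕ) (a : ℝ) :
    theta (N + 1) a = theta N a + 2 * Real.exp (-a * ((N + 1 : ℕ) : ℝ) ^ 2) := by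
  have h : Finset.Icc (-((N + 1 : ℕ) : ℤ)) (N + 1 : ℕ) =
      insert (-((N + 1 : ℕ) : ℤ)) (insert ((N + 1 : ℕ) : ℤ) (Finset.Icc (-(N : ℤ)) N)) := by
    ext k
    simp only [Finset.mem_Icc, Finset.mem_insert]
    push_cast
    omega
  rw [theta, h, Finset.sum_insert, Finset.sum_insert, theta]
  · push_cast; ring_nf
  · simp
  · simp only [Finset.mem_insert, Finset.mem_Icc]
    push_cast
    omega

theorem theta_eq (N : ℕ) (a : ℝ) :
    theta N a = 1 + 2 * ∑ i ∈ Finset.range N, Real.exp (-a * ((i + 1 : ℕ) : ℝ) ^ 2) := by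
  induction N with
  | zero => simp [theta]
  | succ N ih => rw [theta_succ, ih, Finset.sum_range_succ]; ring

theorem one_le_theta (N : ℕ) (a : ℝ) : 1 ≤ theta N a := by
  rw [theta_eq]
  have : 0 ≤ ∑ i ∈ Finset.range N, Real.exp (-a * ((i + 1 : ℕ) : ℝ) ^ 2) :=
    Finset.sum_nonneg fun i _ => (Real.exp_pos _).le
  linarith

/-- On the half line the integrand decreases from 1, so upper and lower Riemann sums with unit steps
differ by at most 1 and enclose the integral. -/
theorem abs_theta_sub_le (N : ℕ) {a : ℝ} (ha : 0 ≤ a) :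
    |theta N a - 2 * ∫ x in (0 : ℝ)..N, Real.exp (-a * x ^ 2)| ≤ 1 := by
  have hanti : AntitoneOn (fun x : ℝ => Real.exp (-a * x ^ 2)) (Set.Icc 0 (0 + (N : ℝ))) := by
    intro x hx y hy hxy
    have := pow_le_pow_left₀ hx.1 hxy 2
    exact Real.exp_le_exp.2 (by nlinarith)
  have h1 := hanti.integral_le_sum
  have h2 := hanti.sum_le_integral
  simp only [zero_add] at h1 h2
  have h3 : ∑ i ∈ Finset.range N, Real.exp (-a * (i : ℝ) ^ 2) ≤
      1 + ∑ i ∈ Finset.range N, Real.exp (-a * ((i + 1 : ℕ) : ℝ) ^ 2) := by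
    have := Finset.sum_range_succ' (fun i : ℕ => Real.exp (-a * (i : ℝ) ^ 2)) N
    rw [Finset.sum_range_succ] at this
    have h0 := Real.exp_pos (-a * (N : ℝ) ^ 2)
    have h4 : Real.exp (-a * ((0 : ℕ) : ℝ) ^ 2) = 1 := by simp
    rw [h4] at this
    linarith
  rw [theta_eq, abs_le]
  constructor <;> linarith

/-- `theta` behaves like `√(π/a)`: after rescaling by `√a` the Riemann error is at most `√a`, and `N
√a → ∞` makes the truncation harmless. -/
theorem tendsto_theta_mul_sqrt {ι : Type*} {l : Filter ι} [l.IsCountablyGenerated] {N : ι → ℕ}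
    {a : ι → ℝ} (ha : ∀ i, 0 < a i) (ha0 : Tendsto a l (𝓝 0))
    (hN : Tendsto (fun i => (N i : ℝ) * √(a i)) l atTop) :
    Tendsto (fun i => theta (N i) (a i) * √(a i)) l (𝓝 √Real.pi) := by
  have hsqrt : Tendsto (fun i => √(a i)) l (𝓝 0) := by
    simpa [Function.comp_def] using (Real.continuous_sqrt.tendsto 0).comp ha0
  have hint : IntegrableOn (fun x : ℝ => Real.exp (-1 * x ^ 2)) (Set.Ioi 0) :=
    (integrable_exp_neg_mul_sq one_pos).integrableOn
  have h1 := (intervalIntegral_tendsto_integral_Ioi 0 hint hN).const_mul 2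
  rw [integral_gaussian_Ioi, div_one, mul_div_cancel₀ _ two_ne_zero] at h1
  have hcv : ∀ i, (∫ x in (0 : ℝ)..N i, Real.exp (-a i * x ^ 2)) * √(a i) =
      ∫ x in (0 : ℝ)..(N i) * √(a i), Real.exp (-1 * x ^ 2) := by
    intro i
    have h := intervalIntegral.integral_comp_mul_right (a := 0) (b := N i)
      (fun x : ℝ => Real.exp (-1 * x ^ 2)) (Real.sqrt_pos.2 (ha i)).ne'
    have h0 := Real.sqrt_pos.2 (ha i)
    simp only [zero_mul, smul_eq_mul, mul_pow, Real.sq_sqrt (ha i).le] at h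
    rw [eq_inv_mul_iff_mul_eq₀ h0.ne'] at h
    rw [← h, mul_comm]
    congr 2
    funext x
    congr 1
    ring
  have h2 : Tendsto (fun i => theta (N i) (a i) * √(a i) -
      2 * ∫ x in (0 : ℝ)..(N i) * √(a i), Real.exp (-1 * x ^ 2)) l (𝓝 0) := by
    refine squeeze_zero_norm (fun i => ?_) hsqrt
    rw [← hcv, Real.norm_eq_abs, ← mul_assoc, ← sub_mul, abs_mul, abs_of_nonneg (Real.sqrt_nonneg _)]
    exact mul_le_of_le_one_left (Real.sqrt_nonneg _) (abs_theta_sub_le _ (ha i).le)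
  simpa using h2.add h1

theorem tendsto_theta_ratio {ι : Type*} {l : Filter ι} [l.IsCountablyGenerated] {N : ι → ℕ}
    {a : ι → ℝ} (ha : ∀ i, 0 < a i) (ha0 : Tendsto a l (𝓝 0))
    (hN : Tendsto (fun i => (N i : ℝ) * √(a i)) l atTop) {c : ℝ} (hc : 0 < c) :
    Tendsto (fun i => theta (N i) (c * a i) / theta (N i) (a i)) l (𝓝 (√c)⁻¹) := by
  have hsc := Real.sqrt_pos.2 hc
  have h1 := tendsto_theta_mul_sqrt (N := N) (l := l) (a := fun i => c * a i)
    (fun i => mul_pos hc (ha i)) (by simpa using ha0.const_mul c) (by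
      refine (hN.const_mul_atTop hsc).congr fun i => ?_
      rw [Real.sqrt_mul hc.le]; ring)
  have h2 := tendsto_theta_mul_sqrt ha ha0 hN
  have hpi := Real.sqrt_pos.2 Real.pi_pos
  have h3 := (h1.div h2 hpi.ne').div_const √c
  rw [div_self hpi.ne', one_div] at h3
  refine h3.congr fun i => ?_
  have := Real.sqrt_pos.2 (ha i)
  have h4 : 0 < theta (N i) (a i) := one_pos.trans_le (one_le_theta _ _)
  simp only [Pi.div_apply]
  rw [Real.sqrt_mul hc.le]
  field_simp

end Theta

/-! ### Concentration of the Gaussian weight on a shell, and collision bounds. -/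

section Shell

variable {n : ℕ}

/-- The integer points of the cube `[-N, N]ⁿ`. -/
noncomputable def intBox (n N : ℕ) : Finset (Fin n → ℤ) := Fintype.piFinset fun _ => Finset.Icc (-(N : ℤ)) N

/-- The squared norm of an integer vector. -/
noncomputable def normSq (u : Fin n → ℤ) : ℝ := ∑ j, (u j : ℝ) ^ 2

theorem norm_intPoint_sq (u : Fin n → ℤ) : ‖intPoint u‖ ^ 2 = normSq u := by
  rw [EuclideanSpace.norm_sq_eq]
  simp [normSq]

theorem exp_neg_mul_normSq (b : ℝ) (u : Fin n → ℤ) :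
    Real.exp (-b * normSq u) = ∏ j, Real.exp (-b * (u j : ℝ) ^ 2) := by
  rw [normSq, Finset.mul_sum, Real.exp_sum]

theorem sum_intBox (N : ℕ) (b : ℝ) :
    ∑ u ∈ intBox n N, Real.exp (-b * normSq u) = theta N b ^ n := by
  simp only [exp_neg_mul_normSq, intBox]
  rw [Finset.sum_prod_piFinset (Finset.Icc (-(N : ℤ)) N) fun _ k => Real.exp (-b * (k : ℝ) ^ 2)]
  simp [theta]

/-- Integer points of the cube `[-N, N]ⁿ` whose squared norm is within a factor `1 ± η` of
`n / (2 a)`, the typical value under the Gaussian weight `exp (-a ‖u‖²)`. -/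
noncomputable def shell (n N : ℕ) (a η : ℝ) : Finset (Fin n → ℤ) :=
  (intBox n N).filter fun u =>
    (1 - η) * (n / (2 * a)) ≤ normSq u ∧ normSq u ≤ (1 + η) * (n / (2 * a))

/-- Chernoff's bound: on the summation range the tilt `exp(s a (normSq u - c))` is at least 1, and
the tilted sum over the cube factorizes over coordinates. -/
theorem sum_gt_le (N : ℕ) {a s c : ℝ} (hs : 0 ≤ s * a) :
    ∑ u ∈ (intBox n N).filter (fun u => c < normSq u), Real.exp (-a * normSq u) ≤
      Real.exp (-(s * a) * c) * theta N ((1 - s) * a) ^ n := by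
  rw [← sum_intBox, Finset.mul_sum]
  refine (Finset.sum_le_sum fun u hu => ?_).trans
    (Finset.sum_le_sum_of_subset_of_nonneg (Finset.filter_subset _ _) fun _ _ _ => by positivity)
  have := (Finset.mem_filter.1 hu).2
  rw [← Real.exp_add]
  refine Real.exp_le_exp.2 ?_
  nlinarith

theorem sum_lt_le (N : ℕ) {a s c : ℝ} (hs : 0 ≤ s * a) :
    ∑ u ∈ (intBox n N).filter (fun u => normSq u < c), Real.exp (-a * normSq u) ≤
      Real.exp (s * a * c) * theta N ((1 + s) * a) ^ n := by
  rw [← sum_intBox, Finset.mul_sum]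
  refine (Finset.sum_le_sum fun u hu => ?_).trans
    (Finset.sum_le_sum_of_subset_of_nonneg (Finset.filter_subset _ _) fun _ _ _ => by positivity)
  have := (Finset.mem_filter.1 hu).2
  rw [← Real.exp_add]
  refine Real.exp_le_exp.2 ?_
  nlinarith

theorem theta_pow_le_sum_shell_add (N : ℕ) {a s s' η : ℝ} (ha : 0 < a) (hs : 0 ≤ s) (hs' : 0 ≤ s') :
    theta N a ^ n ≤ ∑ u ∈ shell n N a η, Real.exp (-a * normSq u) +
      (Real.exp (-(s * (1 + η) / 2)) * theta N ((1 - s) * a)) ^ n +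
      (Real.exp (s' * (1 - η) / 2) * theta N ((1 + s') * a)) ^ n := by
  have h1 := sum_gt_le (n := n) N (a := a) (s := s) (c := (1 + η) * (n / (2 * a))) (by positivity)
  have h2 := sum_lt_le (n := n) N (a := a) (s := s') (c := (1 - η) * (n / (2 * a))) (by positivity)
  have e1 : Real.exp (-(s * a) * ((1 + η) * (n / (2 * a)))) * theta N ((1 - s) * a) ^ n =
      (Real.exp (-(s * (1 + η) / 2)) * theta N ((1 - s) * a)) ^ n := by
    rw [mul_pow, ← Real.exp_nat_mul]; congr 2; field_simp
  have e2 : Real.exp (s' * a * ((1 - η) * (n / (2 * a)))) * theta N ((1 + s') * a) ^ n =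
      (Real.exp (s' * (1 - η) / 2) * theta N ((1 + s') * a)) ^ n := by
    rw [mul_pow, ← Real.exp_nat_mul]; congr 2; field_simp
  rw [e1] at h1
  rw [e2] at h2
  refine le_trans ?_ (add_le_add (add_le_add le_rfl h1) h2)
  rw [← sum_intBox, shell, Finset.sum_filter, Finset.sum_filter, Finset.sum_filter,
    ← Finset.sum_add_distrib, ← Finset.sum_add_distrib]
  refine Finset.sum_le_sum fun u _ => ?_
  have h0 := Real.exp_pos (-a * normSq u)
  split_ifs with h3 h4 h5 <;> first | linarith | skip
  exact absurd ⟨not_lt.1 ‹_›, not_lt.1 ‹_›⟩ h3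

theorem tendsto_pow_zero_of_base {l : Filter ℕ} (hl : l ≤ atTop) {x : ℕ → ℝ} (hx : ∀ n, 0 ≤ x n)
    {c : ℝ} (hc : c < 1) (h : Tendsto x l (𝓝 c)) : Tendsto (fun n => x n ^ n) l (𝓝 0) := by
  obtain ⟨d, hcd, hd⟩ := exists_between hc
  by_cases hbot : l = ⊥
  · simp [hbot]
  have : l.NeBot := ⟨hbot⟩
  have hc0 : 0 ≤ c := ge_of_tendsto' h hx
  refine squeeze_zero' (Eventually.of_forall fun n => pow_nonneg (hx n) n) ?_
    ((tendsto_pow_atTop_nhds_zero_of_lt_one (hc0.trans hcd.le) hd).mono_left hl)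
  filter_upwards [h.eventually_lt_const hcd] with n hn
  exact pow_le_pow_left₀ (hx n) hn.le n

/-- The shell carries at least half of the total Gaussian weight. -/
theorem eventually_theta_pow_le {l : Filter ℕ} [l.IsCountablyGenerated] (hl : l ≤ atTop)
    {N : ℕ → ℕ} {a : ℕ → ℝ} (ha : ∀ i, 0 < a i) (ha0 : Tendsto a l (𝓝 0))
    (hN : Tendsto (fun i => (N i : ℝ) * √(a i)) l atTop) {η : ℝ} (hη : 0 < η) :
    ∀ᶠ n in l, theta (N n) (a n) ^ n ≤
      2 * ∑ u ∈ shell n (N n) (a n) η, Real.exp (-a n * normSq u) := by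
  -- With `1 - s = 2/(2+η)`, the bound `log x ≥ 1 - 1/x` gives `log (1 - s) ≥ -η/2`, which exceeds
  -- `-s(1+η)`. For the lower tail the tilt `η` itself works, with margin `η³/(1+η)`.
  set s : ℝ := η / (2 + η) with hs
  have hs0 : 0 < s := by positivity
  have h1s : 1 - s = 2 / (2 + η) := by rw [hs]; field_simp; ring
  have h1s0 : 0 < 1 - s := by rw [h1s]; positivity
  have key : ∀ x c : ℝ, 0 < c → 2 * x < Real.log c → Real.exp x * (√c)⁻¹ < 1 := by
    intro x c hc h
    have hsc := Real.sqrt_pos.2 hc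
    rw [mul_inv_lt_iff₀ hsc, one_mul, ← Real.lt_log_iff_exp_lt hsc, Real.log_sqrt hc.le]
    linarith
  have hb1 : Real.exp (-(s * (1 + η) / 2)) * (√(1 - s))⁻¹ < 1 := by
    refine key _ _ h1s0 ?_
    have := Real.one_sub_inv_le_log_of_pos h1s0
    refine lt_of_lt_of_le ?_ this
    rw [h1s, hs]
    field_simp
    nlinarith
  have hb2 : Real.exp (η * (1 - η) / 2) * (√(1 + η))⁻¹ < 1 := by
    refine key _ _ (by positivity) ?_
    have := Real.one_sub_inv_le_log_of_pos (show 0 < 1 + η by positivity)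
    refine lt_of_lt_of_le ?_ this
    rw [← sub_pos]
    have : 1 - (1 + η)⁻¹ - 2 * (η * (1 - η) / 2) = η ^ 3 / (1 + η) := by field_simp; ring
    rw [this]
    positivity
  have hθ : ∀ n, 0 < theta (N n) (a n) := fun n => one_pos.trans_le (one_le_theta _ _)
  have t1 := tendsto_pow_zero_of_base hl (fun n => by
    have := one_le_theta (N n) ((1 - s) * a n)
    have := hθ n
    positivity) hb1 ((tendsto_theta_ratio ha ha0 hN h1s0).const_mul _)
  have t2 := tendsto_pow_zero_of_base hl (fun n => by
    have := one_le_theta (N n) ((1 + η) * a n)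
    have := hθ n
    positivity) hb2 ((tendsto_theta_ratio ha ha0 hN (show 0 < 1 + η by positivity)).const_mul _)
  filter_upwards [t1.eventually_lt_const (show (0 : ℝ) < 1 / 4 by norm_num),
    t2.eventually_lt_const (show (0 : ℝ) < 1 / 4 by norm_num)] with n h1 h2
  have h3 := theta_pow_le_sum_shell_add (n := n) (N n) (η := η) (ha n) hs0.le hη.le
  have hpos : 0 < theta (N n) (a n) ^ n := pow_pos (hθ n) n
  rw [mul_div_assoc', div_pow, div_lt_iff₀ hpos] at h1 h2
  linarith

-- The part `b` of the exponent is traded for the lower bound on the norm in the shell. What remains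
-- factorizes over the cube: a prescribed coordinate contributes at most 1, a free one `theta N (a -
-- b)`.
open Classical in
theorem sum_shell_agree_le (N : ℕ) {a b η : ℝ} (hb : 0 ≤ b) (hba : b ≤ a) (Z : Finset (Fin n))
    (z : Fin n → ℤ) :
    ∑ u ∈ shell n N a η, Real.exp (-a * normSq u) * (if ∀ j ∈ Z, z j = u j then 1 else 0) ≤
      Real.exp (-b * ((1 - η) * (n / (2 * a)))) * theta N (a - b) ^ (n - Z.card) := by
  have h1 : ∀ u ∈ shell n N a η,
      Real.exp (-a * normSq u) * (if ∀ j ∈ Z, z j = u j then (1 : ℝ) else 0) ≤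
      Real.exp (-b * ((1 - η) * (n / (2 * a)))) * (Real.exp (-(a - b) * normSq u) *
        if ∀ j ∈ Z, z j = u j then 1 else 0) := by
    intro u hu
    have h2 := (Finset.mem_filter.1 hu).2.1
    rw [← mul_assoc]
    refine mul_le_mul_of_nonneg_right ?_ (by split_ifs <;> norm_num)
    rw [← Real.exp_add]
    refine Real.exp_le_exp.2 ?_
    nlinarith
  refine (Finset.sum_le_sum h1).trans ?_
  rw [← Finset.mul_sum]
  refine mul_le_mul_of_nonneg_left ?_ (Real.exp_pos _).le
  have h3 : ∀ u : Fin n → ℤ, Real.exp (-(a - b) * normSq u) *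
      (if ∀ j ∈ Z, z j = u j then (1 : ℝ) else 0) =
      ∏ j, Real.exp (-(a - b) * (u j : ℝ) ^ 2) * (if j ∈ Z → z j = u j then 1 else 0) := by
    intro u
    rw [Finset.prod_mul_distrib, ← exp_neg_mul_normSq, Finset.prod_boole]
    simp
  have h4 : ∀ j : Fin n, ∑ k ∈ Finset.Icc (-(N : ℤ)) N, Real.exp (-(a - b) * (k : ℝ) ^ 2) *
      (if j ∈ Z → z j = k then 1 else 0) ≤ if j ∈ Z then 1 else theta N (a - b) := by
    intro j
    by_cases hj : j ∈ Z
    · simp only [hj, forall_const, if_true, mul_ite, mul_one, mul_zero, Finset.sum_ite_eq]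
      split_ifs
      · exact Real.exp_le_one_iff.2 (by nlinarith [sq_nonneg (z j : ℝ)])
      · exact zero_le_one
    · simp [hj, theta]
  calc _ ≤ ∑ u ∈ intBox n N, Real.exp (-(a - b) * normSq u) *
        (if ∀ j ∈ Z, z j = u j then (1 : ℝ) else 0) :=
        Finset.sum_le_sum_of_subset_of_nonneg (Finset.filter_subset _ _) fun _ _ _ =>
          mul_nonneg (Real.exp_pos _).le (by split_ifs <;> norm_num)
    _ = ∏ j, ∑ k ∈ Finset.Icc (-(N : ℤ)) N, Real.exp (-(a - b) * (k : ℝ) ^ 2) *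
        (if j ∈ Z → z j = k then 1 else 0) := by
        simp only [h3, intBox]
        exact Finset.sum_prod_piFinset (Finset.Icc (-(N : ℤ)) N) fun j k =>
          Real.exp (-(a - b) * (k : ℝ) ^ 2) * (if j ∈ Z → z j = k then 1 else 0)
    _ ≤ ∏ j, if j ∈ Z then 1 else theta N (a - b) :=
        Finset.prod_le_prod (fun j _ => Finset.sum_nonneg fun k _ =>
          mul_nonneg (Real.exp_pos _).le (by split_ifs <;> norm_num)) fun j _ => h4 j
    _ = theta N (a - b) ^ (n - Z.card) := by
        rw [Finset.prod_ite]
        simp only [Finset.prod_const_one, one_mul, Finset.prod_const]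
        congr 1
        rw [Finset.filter_not, Finset.filter_mem_eq_inter, Finset.univ_inter,
          Finset.card_sdiff_of_subset (Finset.subset_univ Z), Finset.card_univ, Fintype.card_fin]

theorem intCast_inj_of_mem_intBox {p N : ℕ} (hp : 2 * N < p) {u v : Fin n → ℤ}
    (hu : u ∈ intBox n N) (hv : v ∈ intBox n N) (j : Fin n) :
    ((u j : ZMod p) = (v j : ZMod p)) ↔ u j = v j := by
  refine ⟨fun h => ?_, fun h => by rw [h]⟩
  have h1 := Finset.mem_Icc.1 (Fintype.mem_piFinset.1 hu j)
  have h2 := Finset.mem_Icc.1 (Fintype.mem_piFinset.1 hv j)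
  rw [ZMod.intCast_eq_intCast_iff_dvd_sub] at h
  have h3 := Int.eq_zero_of_abs_lt_dvd h (by rw [abs_lt]; constructor <;> omega)
  omega

/-- As `2N < p`, agreement modulo `p` is agreement of integers, so for fixed `u` the previous bound
applies uniformly. The shell carries at least half of the total weight, whence the factor 2. -/
theorem collision_shell_le {p N : ℕ} (hp : 2 * N < p) {a b η : ℝ} (hb : 0 ≤ b) (hba : b ≤ a)
    (hM : theta N a ^ n ≤ 2 * ∑ u ∈ shell n N a η, Real.exp (-a * normSq u)) (Z : Finset (Fin n)) :
    collision p (shell n N a η) (fun u => Real.exp (-a * normSq u)) Z ≤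
      2 * Real.exp (-b * ((1 - η) * (n / (2 * a)))) * theta N (a - b) ^ (n - Z.card) /
        theta N a ^ n := by
  classical
  set M := ∑ u ∈ shell n N a η, Real.exp (-a * normSq u) with hMdef
  have hθ : 0 < theta N a ^ n := pow_pos (one_pos.trans_le (one_le_theta _ _)) n
  have hM0 : 0 < M := by linarith
  set D := Real.exp (-b * ((1 - η) * (n / (2 * a)))) * theta N (a - b) ^ (n - Z.card) with hD
  have hD0 : 0 ≤ D := by
    have := one_le_theta N (a - b)
    positivity
  have h1 : collision p (shell n N a η) (fun u => Real.exp (-a * normSq u)) Z ≤ D / M := by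
    rw [collision, div_le_div_iff₀ (by positivity) hM0]
    have : ∑ u ∈ shell n N a η, ∑ u' ∈ shell n N a η, Real.exp (-a * normSq u) *
        Real.exp (-a * normSq u') *
          (if ∀ j ∈ Z, (u j : ZMod p) = (u' j : ZMod p) then (1 : ℝ) else 0) ≤ M * D := by
      rw [hMdef, Finset.sum_mul]
      refine Finset.sum_le_sum fun u hu => ?_
      simp only [mul_assoc]
      rw [← Finset.mul_sum]
      refine mul_le_mul_of_nonneg_left ?_ (Real.exp_pos _).le
      refine le_trans (le_of_eq ?_) (sum_shell_agree_le N hb hba Z u)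
      refine Finset.sum_congr rfl fun u' hu' => ?_
      have : (∀ j ∈ Z, (u j : ZMod p) = (u' j : ZMod p)) ↔ ∀ j ∈ Z, u j = u' j :=
        forall₂_congr fun j _ => intCast_inj_of_mem_intBox hp (Finset.mem_filter.1 hu).1
          (Finset.mem_filter.1 hu').1 j
      simp only [this]
    nlinarith
  refine h1.trans ?_
  rw [div_le_div_iff₀ hM0 hθ, mul_assoc 2, ← hD]
  nlinarith

end Shell

/-! ### Expansion of the graph applied to the union bound. -/

theorem BipGraph.mem_nbrOfLeft {V C : Type} [Fintype V] [Fintype C] {g : BipGraph V C}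
    {S : Finset V} {c : C} : c ∈ g.nbrOfLeft S ↔ ∃ v ∈ S, g.Adj v c := by
  simp [nbrOfLeft]

theorem BipGraph.mem_nbrOfRight {V C : Type} [Fintype V] [Fintype C] {g : BipGraph V C}
    {T : Finset C} {v : V} : v ∈ g.nbrOfRight T ↔ ∃ c ∈ T, g.Adj v c := by
  simp [nbrOfRight]

section Expansion

variable {n m : ℕ} {g : BipGraph (Fin n) (Fin m)} {R α A β B ε ϑ : ℝ}

/-- The complement `S` of `N(T)` has all its neighbours outside `T`, so `|N(S)| ≤ m - |T|`; left
expansion with `α ≥ 1` then gives `|S| ≤ m - |T|`. -/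
theorem BipGraph.IsGood.card_compl_nbrOfRight_add_card_le (hg : g.IsGood R α A β B ε ϑ)
    (hm : (m : ℝ) = n * (1 - R)) (hα : 1 ≤ α) {T : Finset (Fin m)}
    (hT : (n : ℝ) * (1 - R) / 2 < T.card) : n - (g.nbrOfRight T).card + T.card ≤ m := by
  classical
  set S := (g.nbrOfRight T)ᶜ with hS
  have hScard : S.card = n - (g.nbrOfRight T).card := by rw [hS, Finset.card_compl, Fintype.card_fin]
  have hdisj : Disjoint (g.nbrOfLeft S) T := by
    rw [Finset.disjoint_left]
    intro c hc hcT
    obtain ⟨v, hv, hvc⟩ := BipGraph.mem_nbrOfLeft.1 hc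
    rw [hS, Finset.mem_compl] at hv
    exact hv (BipGraph.mem_nbrOfRight.2 ⟨c, hcT, hvc⟩)
  have hcard : (g.nbrOfLeft S).card + T.card ≤ m := by
    rw [← Finset.card_union_of_disjoint hdisj]
    exact (Finset.card_le_univ _).trans (Fintype.card_fin m).le
  have hcard' : ((g.nbrOfLeft S).card : ℝ) + T.card ≤ m := by exact_mod_cast hcard
  have hlarge := hg.left_large
  rw [Fintype.card_fin] at hlarge
  have hα0 : 0 < α := one_pos.trans_le hα
  -- Were `S` too large for (L2), a subset of the threshold size would have at least `n(1-R)/2`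
  -- neighbours, which together with `T` exceed `m`.
  have hSle : S.card ≤ ⌈(n : ℝ) * (1 - R) / (2 * α)⌉₊ := by
    by_contra! h
    obtain ⟨S', hS', hcS'⟩ := Finset.exists_subset_card_eq h.le
    have h1 := hlarge S' hcS'.le
    have h2 : (g.nbrOfLeft S').card ≤ (g.nbrOfLeft S).card := by
      refine Finset.card_le_card fun c hc => ?_
      obtain ⟨v, hv, hvc⟩ := BipGraph.mem_nbrOfLeft.1 hc
      exact BipGraph.mem_nbrOfLeft.2 ⟨v, hS' hv, hvc⟩
    have h3 : ((g.nbrOfLeft S').card : ℝ) ≤ (g.nbrOfLeft S).card := by exact_mod_cast h2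
    have h4 := Nat.le_ceil ((n : ℝ) * (1 - R) / (2 * α))
    rw [← hcS', div_le_iff₀ (by positivity)] at h4
    nlinarith
  have h5 := hlarge S hSle
  have h6 : (S.card : ℝ) ≤ (g.nbrOfLeft S).card := by
    nlinarith [(Nat.cast_nonneg S.card : (0 : ℝ) ≤ S.card)]
  have h7 : S.card ≤ (g.nbrOfLeft S).card := by exact_mod_cast h6
  omega

theorem sum_pow_card (x y : ℝ) :
    ∑ T : Finset (Fin m), x ^ T.card * y ^ (m - T.card) = (x + y) ^ m := by
  have := Finset.sum_pow_mul_eq_add_pow x y (Finset.univ : Finset (Fin m))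
  simpa using this

open Classical in
theorem sum_nonempty_pow_card (x : ℝ) :
    ∑ T : Finset (Fin m) with T.Nonempty, x ^ T.card = (1 + x) ^ m - 1 := by
  have h := sum_pow_card (m := m) x 1
  simp only [one_pow, mul_one] at h
  rw [add_comm 1 x, ← h, ← Finset.sum_filter_add_sum_filter_not Finset.univ Finset.Nonempty]
  simp [Finset.filter_eq']

open Classical in
/-- The expansion of the graph turns bounds on the probability that a random vector vanishes on a
set of coordinates into a bound on the sum over all sets of silent checks. -/
theorem sum_pow_mul_le_of_isGood (hg : g.IsGood R α A β B ε ϑ)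
    (hm : (m : ℝ) = n * (1 - R)) (hα : 1 ≤ α) {p θ Θ E : ℝ} {f : Finset (Fin n) → ℝ}
    (hp : 1 ≤ p) (hθ : 1 ≤ θ) (hE : 0 ≤ E) (hΘ1 : 1 ≤ Θ)
    (hpβ : p * θ ^ (-β) ≤ 1)
    (hf1 : ∀ Z, f Z ≤ 2 / θ ^ Z.card) (hf3 : ∀ Z, f Z ≤ 2 * E * Θ ^ (n - Z.card) / θ ^ n) :
    ∑ T : Finset (Fin m) with T.Nonempty, p ^ T.card * f (g.nbrOfRight T) ≤
      2 * ((1 + p * θ ^ (-B)) ^ m - 1) + 2 * (2 ^ m * (p * θ ^ (-β)) ^ (ϑ * n * (1 - R))) +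
        2 * (E * (p ^ m / θ ^ n) * (1 + Θ / p) ^ m) := by
  have hp0 : 0 < p := one_pos.trans_le hp
  have hθ0 : 0 < θ := one_pos.trans_le hθ
  have hΘ0 : 0 < Θ := one_pos.trans_le hΘ1
  have hexp : ∀ (b : ℝ) (t k : ℕ), b * t ≤ k → p ^ t * (2 / θ ^ k) ≤ 2 * (p * θ ^ (-b)) ^ t := by
    intro b t k h
    have h1 : (θ ^ k)⁻¹ ≤ (θ ^ (-b)) ^ t := by
      rw [← Real.rpow_natCast θ k, ← Real.rpow_neg hθ0.le, ← Real.rpow_mul_natCast hθ0.le]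
      exact Real.rpow_le_rpow_of_exponent_le hθ (by linarith)
    rw [mul_pow, div_eq_mul_inv]
    have := mul_le_mul_of_nonneg_left h1 (show 0 ≤ 2 * p ^ t by positivity)
    linarith
  -- The size of `T` selects one of three bounds; adding all three, each nonnegative, avoids
  -- splitting the sum.
  have hterm : ∀ T ∈ (Finset.univ.filter fun T : Finset (Fin m) => T.Nonempty),
      p ^ T.card * f (g.nbrOfRight T) ≤ 2 * (p * θ ^ (-B)) ^ T.card +
        2 * (p * θ ^ (-β)) ^ (ϑ * n * (1 - R)) +
        2 * (E * (p ^ m / θ ^ n) * (1 ^ T.card * (Θ / p) ^ (m - T.card))) := by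
    intro T _
    have n1 : 0 ≤ 2 * (p * θ ^ (-B)) ^ T.card := by positivity
    have n2 : 0 ≤ 2 * (p * θ ^ (-β)) ^ (ϑ * n * (1 - R)) := by positivity
    have n3 : 0 ≤ 2 * (E * (p ^ m / θ ^ n) * (1 ^ T.card * (Θ / p) ^ (m - T.card))) := by positivity
    rcases le_or_gt (T.card : ℝ) (ϑ * n * (1 - R)) with h1 | h1
    · have h := hg.right_small T (by simpa using h1)
      have := (mul_le_mul_of_nonneg_left (hf1 (g.nbrOfRight T)) (by positivity)).trans
        (hexp B T.card _ h)
      linarith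
    rcases le_or_gt (T.card : ℝ) (n * (1 - R) / 2) with h2 | h2
    · have h := hg.right_large T (by simpa using h2)
      have h3 := (mul_le_mul_of_nonneg_left (hf1 (g.nbrOfRight T)) (by positivity)).trans
        (hexp β T.card _ h)
      have h4 : (p * θ ^ (-β)) ^ T.card ≤ (p * θ ^ (-β)) ^ (ϑ * n * (1 - R)) := by
        rw [← Real.rpow_natCast]
        exact Real.rpow_le_rpow_of_exponent_ge (by positivity) hpβ h1.le
      linarith
    · have h := hg.card_compl_nbrOfRight_add_card_le hm hα h2
      have hu : p ^ m = p ^ T.card * p ^ (m - T.card) := by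
        rw [← pow_add]; congr 1; omega
      have h3 := mul_le_mul_of_nonneg_left (hf3 (g.nbrOfRight T)) (show 0 ≤ p ^ T.card by positivity)
      -- After this replacement the term depends only on `|T|`, and the sum over `T` is bounded by
      -- the binomial expansion of `(1 + Θ/p)^m`.
      have h4 : Θ ^ (n - (g.nbrOfRight T).card) ≤ Θ ^ (m - T.card) :=
        pow_le_pow_right₀ hΘ1 (by omega)
      have h5 : p ^ T.card * (2 * E * Θ ^ (m - T.card) / θ ^ n) =
          2 * (E * (p ^ m / θ ^ n) * (1 ^ T.card * (Θ / p) ^ (m - T.card))) := by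
        rw [one_pow, div_pow, hu]
        field_simp
      have h6 : p ^ T.card * (2 * E * Θ ^ (n - (g.nbrOfRight T).card) / θ ^ n) ≤
          p ^ T.card * (2 * E * Θ ^ (m - T.card) / θ ^ n) := by gcongr
      linarith
  refine (Finset.sum_le_sum hterm).trans ?_
  rw [Finset.sum_add_distrib, Finset.sum_add_distrib, ← Finset.mul_sum, ← Finset.mul_sum,
    ← Finset.mul_sum, ← Finset.mul_sum, sum_nonempty_pow_card]
  refine add_le_add (add_le_add le_rfl ?_) ?_
  · refine mul_le_mul_of_nonneg_left ?_ zero_le_two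
    rw [Finset.sum_const, nsmul_eq_mul]
    refine mul_le_mul_of_nonneg_right ?_ (by positivity)
    have : (Finset.univ.filter fun T : Finset (Fin m) => T.Nonempty).card ≤ 2 ^ m :=
      (Finset.card_le_univ _).trans (by simp)
    exact_mod_cast this
  · refine mul_le_mul_of_nonneg_left (mul_le_mul_of_nonneg_left ?_ (by positivity)) zero_le_two
    rw [← sum_pow_card]
    exact Finset.sum_le_sum_of_subset_of_nonneg (Finset.filter_subset _ _) fun _ _ _ => by positivity

-- Two ranges suffice: up to half the checks `|N(T)| ≥ β|T|`, and beyond that `|N(T)| - |T| ≥ n -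
-- m`.
open Classical in
theorem sum_pow_div_le_of_isGood (hg : g.IsGood R α A β B ε ϑ)
    (hm : (m : ℝ) = n * (1 - R)) (hα : 1 ≤ α) {p : ℝ} (hp : 1 ≤ p) (hmn : m ≤ n) :
    ∑ T : Finset (Fin m) with T.Nonempty, p ^ T.card / p ^ (g.nbrOfRight T).card ≤
      ((1 + p ^ (1 - β)) ^ m - 1) + 2 ^ m / p ^ (n - m) := by
  have hp0 : 0 < p := one_pos.trans_le hp
  have hterm : ∀ T ∈ (Finset.univ.filter fun T : Finset (Fin m) => T.Nonempty),
      p ^ T.card / p ^ (g.nbrOfRight T).card ≤ (p ^ (1 - β)) ^ T.card + 1 / p ^ (n - m) := by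
    intro T _
    rcases le_or_gt (T.card : ℝ) (n * (1 - R) / 2) with h2 | h2
    · have h := hg.right_large T (by simpa using h2)
      have h1 : p ^ T.card / p ^ (g.nbrOfRight T).card ≤ (p ^ (1 - β)) ^ T.card := by
        rw [← Real.rpow_natCast, ← Real.rpow_natCast, ← Real.rpow_sub hp0,
          ← Real.rpow_mul_natCast hp0.le]
        exact Real.rpow_le_rpow_of_exponent_le hp (by linarith)
      have h3 : 0 ≤ 1 / p ^ (n - m) := by positivity
      linarith
    · have h := hg.card_compl_nbrOfRight_add_card_le hm hα h2
      have h1 : p ^ T.card / p ^ (g.nbrOfRight T).card ≤ 1 / p ^ (n - m) := by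
        rw [div_le_div_iff₀ (by positivity) (by positivity), one_mul, ← pow_add]
        exact pow_le_pow_right₀ hp (by omega)
      have h3 : 0 ≤ (p ^ (1 - β)) ^ T.card := by positivity
      linarith
  refine (Finset.sum_le_sum hterm).trans ?_
  rw [Finset.sum_add_distrib, sum_nonempty_pow_card]
  refine add_le_add le_rfl ?_
  rw [Finset.sum_const, nsmul_eq_mul, mul_one_div]
  refine div_le_div_of_nonneg_right ?_ (by positivity)
  have : (Finset.univ.filter fun T : Finset (Fin m) => T.Nonempty).card ≤ 2 ^ m :=
    (Finset.card_le_univ _).trans (by simp)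
  exact_mod_cast this

end Expansion

/-! ### Growth of the field size and decay of the contributions of small, medium and large sets. -/

section Asymptotics

theorem fieldSize_gt (lam : ℝ) (n : ℕ) : (n : ℝ) ^ lam < fieldSize lam n := by
  classical
  exact (Nat.find_spec (exists_prime_gt lam n)).2

/-- Bertrand's postulate. Since `p` is polynomial in `n`, the factor `p^(2R)` loses against any
exponential decay. -/
theorem fieldSize_le {lam : ℝ} (hlam : 0 ≤ lam) {n : ℕ} (hn : 1 ≤ n) :
    (fieldSize lam n : ℝ) ≤ 2 * (n : ℝ) ^ lam := by
  classical
  have h1 : (1 : ℝ) ≤ (n : ℝ) ^ lam := Real.one_le_rpow (by exact_mod_cast hn) hlam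
  have hk : ⌊(n : ℝ) ^ lam⌋₊ ≠ 0 := (Nat.floor_pos.2 h1).ne'
  obtain ⟨q, hq, hlt, hle⟩ := Nat.exists_prime_lt_and_le_two_mul _ hk
  have h2 : fieldSize lam n ≤ q := Nat.find_min' _ ⟨hq, (Nat.floor_lt (by positivity)).1 hlt⟩
  calc (fieldSize lam n : ℝ) ≤ q := by exact_mod_cast h2
    _ ≤ 2 * (⌊(n : ℝ) ^ lam⌋₊ : ℝ) := by exact_mod_cast hle
    _ ≤ _ := by linarith [Nat.floor_le (show 0 ≤ (n : ℝ) ^ lam by positivity)]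

theorem one_lt_fieldSize (lam : ℝ) (n : ℕ) : (1 : ℝ) < fieldSize lam n := by
  exact_mod_cast (fieldSize_prime lam n).one_lt

theorem tendsto_fieldSize {lam : ℝ} (hlam : 0 < lam) :
    Tendsto (fun n => (fieldSize lam n : ℝ)) atTop atTop :=
  tendsto_atTop_mono (fun n => (fieldSize_gt lam n).le)
    ((tendsto_rpow_atTop hlam).comp tendsto_natCast_atTop_atTop)

theorem tendsto_natCast_mul_fieldSize_rpow {lam R : ℝ} (hR : 0 < R) (hlam : 1 / R < lam) :
    Tendsto (fun n : ℕ => (n : ℝ) * (fieldSize lam n : ℝ) ^ (-R)) atTop (𝓝 0) := by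
  have hexp : 0 < lam * R - 1 := by
    rw [div_lt_iff₀ hR] at hlam; linarith
  have h0 := (tendsto_rpow_neg_atTop hexp).comp (tendsto_natCast_atTop_atTop (R := ℝ))
  refine squeeze_zero' (Eventually.of_forall fun n => by positivity) ?_ h0
  filter_upwards [eventually_ge_atTop 1] with n hn
  have hn' : (0 : ℝ) < n := by exact_mod_cast hn
  have h1 : (fieldSize lam n : ℝ) ^ (-R) ≤ ((n : ℝ) ^ lam) ^ (-R) :=
    Real.rpow_le_rpow_of_nonpos (by positivity) (fieldSize_gt lam n).le (by linarith)
  calc (n : ℝ) * (fieldSize lam n : ℝ) ^ (-R) ≤ (n : ℝ) * ((n : ℝ) ^ lam) ^ (-R) := by gcongr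
    _ = (n : ℝ) ^ (-(lam * R - 1)) := by
      rw [← Real.rpow_mul hn'.le, ← Real.rpow_one_add' hn'.le (by linarith)]
      congr 1; ring
    _ = _ := rfl

theorem tendsto_fieldSize_rpow_mul_exp {lam s c : ℝ} (hlam : 0 ≤ lam) (hs : 0 ≤ s) (hc : 0 < c) :
    Tendsto (fun n : ℕ => (fieldSize lam n : ℝ) ^ s * Real.exp (-c * n)) atTop (𝓝 0) := by
  have h0 := ((tendsto_rpow_mul_exp_neg_mul_atTop_nhds_zero (lam * s) c hc).comp
    (tendsto_natCast_atTop_atTop (R := ℝ))).const_mul (2 ^ s)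
  rw [mul_zero] at h0
  refine squeeze_zero' (Eventually.of_forall fun n => by positivity) ?_ h0
  filter_upwards [eventually_ge_atTop 1] with n hn
  have h1 := Real.rpow_le_rpow (by positivity) (fieldSize_le hlam hn) hs
  rw [Real.mul_rpow (by positivity) (by positivity), ← Real.rpow_mul (by positivity)] at h1
  calc _ ≤ _ := mul_le_mul_of_nonneg_right h1 (Real.exp_pos _).le
    _ = _ := by simp only [Function.comp_apply]; ring

theorem one_add_pow_sub_one_le {x : ℝ} (hx : 0 ≤ x) {m : ℕ} (h : m * x ≤ 1) :
    (1 + x) ^ m - 1 ≤ 2 * (m * x) := by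
  have h0 : 0 ≤ m * x := by positivity
  have h1 : (1 + x) ^ m ≤ Real.exp (m * x) := by
    rw [Real.exp_nat_mul]
    exact pow_le_pow_left₀ (by linarith) (by linarith [Real.add_one_le_exp x]) m
  have h2 := Real.abs_exp_sub_one_le (x := m * x) (by rwa [abs_of_nonneg h0])
  rw [abs_of_nonneg h0] at h2
  linarith [le_abs_self (Real.exp (m * x) - 1)]

variable {l : Filter ℕ} {lam R : ℝ} {m : ℕ → ℕ}

/-- A union bound with small sets: `m · x → 0` makes `(1 + x)ᵐ - 1` negligible, with a margin. -/
theorem tendsto_mul_one_add_pow_sub_one {w x : ℕ → ℝ} (hw : ∀ n, 1 ≤ w n) (hx : ∀ n, 0 ≤ x n)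
    (h : Tendsto (fun n => w n * (m n * x n)) l (𝓝 0)) :
    Tendsto (fun n => w n * ((1 + x n) ^ m n - 1)) l (𝓝 0) := by
  have h2 := h.const_mul 2
  rw [mul_zero] at h2
  refine squeeze_zero' (Eventually.of_forall fun n => mul_nonneg (zero_le_one.trans (hw n))
    (sub_nonneg.2 (one_le_pow₀ (by linarith [hx n])))) ?_ h2
  filter_upwards [h.eventually_le_const one_pos] with n hn
  have h0 : 0 ≤ m n * x n := mul_nonneg (Nat.cast_nonneg _) (hx n)
  have h1 : m n * x n ≤ 1 := by nlinarith [hw n]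
  have := mul_le_mul_of_nonneg_left (one_add_pow_sub_one_le (hx n) h1)
    (zero_le_one.trans (hw n))
  linarith

theorem fieldSize_mul_rpow_neg_le {c ρ b θ : ℝ} (hc : 0 < c) (hb : 0 ≤ b) {n : ℕ}
    (h : c * (fieldSize lam n : ℝ) ^ ρ ≤ θ) :
    (fieldSize lam n : ℝ) * θ ^ (-b) ≤ c ^ (-b) * (fieldSize lam n : ℝ) ^ (1 - ρ * b) := by
  have hp : (0 : ℝ) < fieldSize lam n := one_pos.trans (one_lt_fieldSize lam n)
  have h1 : θ ^ (-b) ≤ (c * (fieldSize lam n : ℝ) ^ ρ) ^ (-b) :=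
    Real.rpow_le_rpow_of_nonpos (by positivity) h (by linarith)
  rw [Real.mul_rpow hc.le (by positivity), ← Real.rpow_mul hp.le] at h1
  calc _ ≤ (fieldSize lam n : ℝ) * (c ^ (-b) * (fieldSize lam n : ℝ) ^ (ρ * -b)) := by gcongr
    _ = c ^ (-b) * ((fieldSize lam n : ℝ) ^ (1 : ℝ) * (fieldSize lam n : ℝ) ^ (ρ * -b)) := by
      rw [Real.rpow_one]; ring
    _ = _ := by rw [← Real.rpow_add hp]; congr 2; ring

/-- Up to constants, `p θ^(-B)` is at most `p^(1-(1-R)B)`. The condition on `B` makes this, times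
`p^(2R)`, at most `p^(-R)`, and `n p^(-R) → 0` because `lam > 1/R`. -/
theorem tendsto_small_sets (hl : l ≤ atTop) (hR0 : 0 < R) (hR1 : R < 1) (hlam : 1 / R < lam)
    (hm : ∀ᶠ n in l, (m n : ℝ) ≤ n) {θ : ℕ → ℝ} (hθ1 : ∀ n, 1 ≤ θ n) {c B : ℝ} (hc : 0 < c)
    (hθ : ∀ᶠ n in l, c * (fieldSize lam n : ℝ) ^ (1 - R) ≤ θ n)
    (hB : 2 * (1 + R) / (1 - R) < B) :
    Tendsto (fun n => (fieldSize lam n : ℝ) ^ (2 * R) *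
      ((1 + fieldSize lam n * θ n ^ (-B)) ^ m n - 1)) l (𝓝 0) := by
  have hB0 : 0 < B := lt_trans (div_pos (by linarith) (by linarith)) hB
  rw [div_lt_iff₀ (by linarith)] at hB
  refine tendsto_mul_one_add_pow_sub_one
    (fun n => Real.one_le_rpow (one_lt_fieldSize lam n).le (by linarith))
    (fun n => mul_nonneg (Nat.cast_nonneg _) (Real.rpow_nonneg (zero_le_one.trans (hθ1 n)) _)) ?_
  have h0 := ((tendsto_natCast_mul_fieldSize_rpow hR0 hlam).mono_left hl).const_mul (c ^ (-B))
  rw [mul_zero] at h0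
  refine squeeze_zero' (Eventually.of_forall fun n => ?_) ?_ h0
  · have := Real.rpow_nonneg (zero_le_one.trans (hθ1 n)) (-B)
    positivity
  filter_upwards [hm, hθ] with n hmn hθn
  have hp1 := one_lt_fieldSize lam n
  have hp : (0 : ℝ) < fieldSize lam n := one_pos.trans hp1
  have h1 := fieldSize_mul_rpow_neg_le hc hB0.le hθn
  calc (fieldSize lam n : ℝ) ^ (2 * R) * (m n * (fieldSize lam n * θ n ^ (-B)))
      ≤ (fieldSize lam n : ℝ) ^ (2 * R) *
        (n * (c ^ (-B) * (fieldSize lam n : ℝ) ^ (1 - (1 - R) * B))) := by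
        have := Real.rpow_nonneg (zero_le_one.trans (hθ1 n)) (-B)
        gcongr
    _ = c ^ (-B) * (n * ((fieldSize lam n : ℝ) ^ (2 * R) *
        (fieldSize lam n : ℝ) ^ (1 - (1 - R) * B))) := by ring
    _ ≤ c ^ (-B) * (n * (fieldSize lam n : ℝ) ^ (-R)) := by
        rw [← Real.rpow_add hp]
        have : (fieldSize lam n : ℝ) ^ (2 * R + (1 - (1 - R) * B)) ≤
            (fieldSize lam n : ℝ) ^ (-R) :=
          Real.rpow_le_rpow_of_exponent_le hp1.le (by nlinarith)
        gcongr

/-- As `β(1-R) > 1`, the base `p θ^(-β)` is a negative power of `p`; raised to a multiple of `n` it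
beats the number `2^m` of sets. -/
theorem tendsto_medium_sets (hl : l ≤ atTop) (hR1 : R < 1) (hlam : 0 < lam)
    (hm : ∀ᶠ n in l, (m n : ℝ) ≤ n) {θ : ℕ → ℝ} (hθ1 : ∀ n, 1 ≤ θ n) {c β ϑ : ℝ} (hc : 0 < c)
    (hθ : ∀ᶠ n in l, c * (fieldSize lam n : ℝ) ^ (1 - R) ≤ θ n)
    (hβ : 1 / (1 - R) < β) (hϑ : 0 < ϑ) :
    (∀ᶠ n in l, (fieldSize lam n : ℝ) * θ n ^ (-β) ≤ 1) ∧
    Tendsto (fun n : ℕ => (fieldSize lam n : ℝ) ^ (2 * R) *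
      (2 ^ m n * (fieldSize lam n * θ n ^ (-β)) ^ (ϑ * n * (1 - R)))) l (𝓝 0) := by
  have hρ : 0 < 1 - R := by linarith
  have hβ0 : 0 < β := lt_trans (by positivity) hβ
  rw [div_lt_iff₀ hρ] at hβ
  -- Half of the available exponent; the other half absorbs the constant `c^(-β)`.
  set κ := ((1 - R) * β - 1) / 2 with hκ
  have hκ0 : 0 < κ := by rw [hκ]; linarith
  have hP := (tendsto_fieldSize hlam).mono_left hl
  have hy : ∀ᶠ n in l, (fieldSize lam n : ℝ) * θ n ^ (-β) ≤ (fieldSize lam n : ℝ) ^ (-κ) := by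
    filter_upwards [hθ, ((tendsto_rpow_neg_atTop hκ0).comp hP).eventually_le_const
      (show (0 : ℝ) < c ^ β by positivity)] with n hθn hn
    have hp : (0 : ℝ) < fieldSize lam n := one_pos.trans (one_lt_fieldSize lam n)
    refine (fieldSize_mul_rpow_neg_le hc hβ0.le hθn).trans ?_
    simp only [Function.comp_apply] at hn
    calc c ^ (-β) * (fieldSize lam n : ℝ) ^ (1 - (1 - R) * β)
        = c ^ (-β) * (fieldSize lam n : ℝ) ^ (-κ) * (fieldSize lam n : ℝ) ^ (-κ) := by
          rw [mul_assoc, ← Real.rpow_add hp]; congr 2; rw [hκ]; ring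
      _ ≤ c ^ (-β) * c ^ β * (fieldSize lam n : ℝ) ^ (-κ) := by gcongr
      _ = _ := by rw [← Real.rpow_add hc]; simp
  refine ⟨?_, ?_⟩
  · filter_upwards [hy] with n hn
    exact hn.trans (Real.rpow_le_one_of_one_le_of_nonpos (one_lt_fieldSize lam n).le (by linarith))
  -- The power is at most `p^(-2γn)`: one factor `p^(-γn)` cancels `p^(2R)`, the other is at most
  -- `4^(-n)` and cancels `2^m`.
  set γ := κ * ϑ * (1 - R) / 2 with hγ
  have hγ0 : 0 < γ := by positivity
  have hhalf := (tendsto_pow_atTop_nhds_zero_of_lt_one (r := (1 / 2 : ℝ)) (by norm_num)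
    (by norm_num)).mono_left hl
  refine squeeze_zero' (Eventually.of_forall fun n => ?_) ?_ hhalf
  · have := Real.rpow_nonneg (zero_le_one.trans (hθ1 n)) (-β)
    positivity
  have hbig : ∀ᶠ n : ℕ in l, 2 * R / γ ≤ (n : ℝ) :=
    (tendsto_natCast_atTop_atTop.mono_left hl).eventually_ge_atTop _
  filter_upwards [hy, hm, hbig, ((tendsto_rpow_neg_atTop hγ0).comp hP).eventually_le_const
      (show (0 : ℝ) < 1 / 4 by norm_num)] with n hyn hmn hn hsmall
  simp only [Function.comp_apply] at hsmall
  have hp1 := one_lt_fieldSize lam n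
  have hp : (0 : ℝ) < fieldSize lam n := one_pos.trans hp1
  have hθ0 := Real.rpow_nonneg (zero_le_one.trans (hθ1 n)) (-β)
  rw [div_le_iff₀ hγ0] at hn
  have h1 : (fieldSize lam n * θ n ^ (-β)) ^ (ϑ * n * (1 - R)) ≤
      (fieldSize lam n : ℝ) ^ (-(2 * γ * n)) := by
    refine (Real.rpow_le_rpow (by positivity) hyn (by positivity)).trans (le_of_eq ?_)
    rw [← Real.rpow_mul hp.le]
    congr 1; rw [hγ]; ring
  have hmn' : m n ≤ n := by exact_mod_cast hmn
  calc _ ≤ (fieldSize lam n : ℝ) ^ (2 * R) * (2 ^ n * (fieldSize lam n : ℝ) ^ (-(2 * γ * n))) := by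
        gcongr
        norm_num
    _ = 2 ^ n * ((fieldSize lam n : ℝ) ^ (2 * R - γ * n) * ((fieldSize lam n : ℝ) ^ (-γ)) ^ n) := by
        rw [← Real.rpow_mul_natCast hp.le, ← Real.rpow_add hp, mul_left_comm, ← Real.rpow_add hp]
        congr 2; ring
    _ ≤ 2 ^ n * (1 * (1 / 4) ^ n) := by
        gcongr
        exact Real.rpow_le_one_of_one_le_of_nonpos hp1.le (by linarith)
    _ = (1 / 2) ^ n := by rw [one_mul, ← mul_pow]; norm_num

/-- Since `p^m = (p^(1-R))ⁿ`, the quotient `p^m/θⁿ` is at most `e^((1-3η)n/2)`, and the shell factor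
turns this into at most `e^(-ηn/2)`. The last factor stays below `e`, as `mΘ/p` is at most `C n
p^(-R) → 0`. -/
theorem tendsto_large_sets (hl : l ≤ atTop) (hR0 : 0 < R) (hlam : 1 / R < lam)
    (hm : ∀ᶠ n in l, (m n : ℝ) = n * (1 - R)) {θ Θ : ℕ → ℝ} (hΘ1 : ∀ n, 1 ≤ Θ n)
    {η C : ℝ} (hη : 0 < η)
    (hθ : ∀ᶠ n in l, Real.exp (-(1 - 3 * η) / 2) * (fieldSize lam n : ℝ) ^ (1 - R) ≤ θ n)
    (hΘ : ∀ᶠ n in l, Θ n ≤ C * (fieldSize lam n : ℝ) ^ (1 - R)) :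
    Tendsto (fun n : ℕ => (fieldSize lam n : ℝ) ^ (2 * R) *
      (Real.exp (-((1 - η) ^ 2 * n / 2)) * ((fieldSize lam n : ℝ) ^ m n / θ n ^ n) *
        (1 + Θ n / fieldSize lam n) ^ m n)) l (𝓝 0) := by
  have hlam0 : 0 < lam := lt_trans (by positivity) hlam
  have h0 := ((tendsto_fieldSize_rpow_mul_exp hlam0.le (s := 2 * R) (c := η / 2) (by linarith)
    (by linarith)).mono_left hl).mul_const (Real.exp 1)
  rw [zero_mul] at h0
  have hsm := ((tendsto_natCast_mul_fieldSize_rpow hR0 hlam).mono_left hl).mul_const C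
  rw [zero_mul] at hsm
  have hθ0 : ∀ᶠ n in l, 0 < θ n := by
    filter_upwards [hθ] with n hn
    have := one_lt_fieldSize lam n
    exact lt_of_lt_of_le (by positivity) hn
  refine squeeze_zero' ?_ ?_ h0
  · filter_upwards [hθ0] with n hn
    have := hΘ1 n
    positivity
  filter_upwards [hm, hθ, hΘ, hsm.eventually_le_const one_pos, hθ0] with n hmn hθn hΘn hn hθ0n
  have hp1 := one_lt_fieldSize lam n
  have hp : (0 : ℝ) < fieldSize lam n := one_pos.trans hp1
  have hΘ0 := hΘ1 n
  have h1 : (fieldSize lam n : ℝ) ^ m n / θ n ^ n ≤ Real.exp ((1 - 3 * η) / 2 * n) := by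
    rw [div_le_iff₀ (by positivity)]
    have h2 := pow_le_pow_left₀ (by positivity) hθn n
    rw [mul_pow, ← Real.rpow_mul_natCast hp.le, ← Real.exp_nat_mul] at h2
    have h3 : (fieldSize lam n : ℝ) ^ m n = (fieldSize lam n : ℝ) ^ ((1 - R) * n) := by
      rw [← Real.rpow_natCast, hmn, mul_comm]
    rw [h3]
    calc (fieldSize lam n : ℝ) ^ ((1 - R) * n) = Real.exp ((1 - 3 * η) / 2 * n) *
          (Real.exp (n * (-(1 - 3 * η) / 2)) * (fieldSize lam n : ℝ) ^ ((1 - R) * n)) := by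
          rw [← mul_assoc, ← Real.exp_add]
          ring_nf
          simp
      _ ≤ _ := by gcongr
  have h4 : (1 + Θ n / fieldSize lam n) ^ m n ≤ Real.exp 1 := by
    have h5 : (1 + Θ n / fieldSize lam n) ^ m n ≤ Real.exp (m n * (Θ n / fieldSize lam n)) := by
      rw [Real.exp_nat_mul]
      refine pow_le_pow_left₀ (by positivity) ?_ _
      linarith [Real.add_one_le_exp (Θ n / fieldSize lam n)]
    refine h5.trans (Real.exp_le_exp.2 (le_trans ?_ hn))
    have h6 : Θ n / fieldSize lam n ≤ C * (fieldSize lam n : ℝ) ^ (-R) := by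
      rw [div_le_iff₀ hp, mul_assoc]
      nth_rewrite 2 [← Real.rpow_one (fieldSize lam n : ℝ)]
      rw [← Real.rpow_add hp, neg_add_eq_sub]
      exact hΘn
    have h7 : 0 ≤ Θ n / fieldSize lam n := by positivity
    have h8 : (m n : ℝ) ≤ n := by
      rw [hmn]; nlinarith [(Nat.cast_nonneg n : (0 : ℝ) ≤ n)]
    calc (m n : ℝ) * (Θ n / fieldSize lam n) ≤ n * (Θ n / fieldSize lam n) := by gcongr
      _ ≤ n * (C * (fieldSize lam n : ℝ) ^ (-R)) := by gcongr
      _ = _ := by ring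
  calc _ ≤ (fieldSize lam n : ℝ) ^ (2 * R) * (Real.exp (-((1 - η) ^ 2 * n / 2)) *
        Real.exp ((1 - 3 * η) / 2 * n) * Real.exp 1) := by gcongr
    _ ≤ (fieldSize lam n : ℝ) ^ (2 * R) * (Real.exp (-(η / 2) * n) * Real.exp 1) := by
        gcongr
        rw [← Real.exp_add]
        refine Real.exp_le_exp.2 ?_
        have : 0 ≤ η ^ 2 * n := by positivity
        nlinarith
    _ = _ := by ring

/-- Here `β > 1/(1-R)` implies `1 - β ≤ -R`, so sets up to half the checks cost `n p^(-R)`; the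
others cost `2^m p^(-Rn)`. -/
theorem tendsto_rank_sets (hl : l ≤ atTop) (hR0 : 0 < R) (hR1 : R < 1) (hlam : 1 / R < lam)
    (hm : ∀ᶠ n in l, (m n : ℝ) = n * (1 - R)) {β : ℝ} (hβ : 1 / (1 - R) < β) :
    Tendsto (fun n : ℕ => ((1 + (fieldSize lam n : ℝ) ^ (1 - β)) ^ m n - 1) +
      2 ^ m n / (fieldSize lam n : ℝ) ^ (n - m n)) l (𝓝 0) := by
  have hlam0 : 0 < lam := lt_trans (by positivity) hlam
  have hmn : ∀ᶠ n in l, (m n : ℝ) ≤ n := by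
    filter_upwards [hm] with n hn
    rw [hn]; nlinarith [(Nat.cast_nonneg n : (0 : ℝ) ≤ n)]
  have hβR : 1 - β ≤ -R := by
    rw [div_lt_iff₀ (by linarith)] at hβ
    nlinarith
  rw [← add_zero (0 : ℝ)]
  refine Tendsto.add ?_ ?_
  · have := tendsto_mul_one_add_pow_sub_one (l := l) (m := m) (w := fun _ => 1)
      (x := fun n => (fieldSize lam n : ℝ) ^ (1 - β)) (fun _ => le_rfl) (fun n => by positivity) ?_
    · simpa using this
    refine squeeze_zero' (Eventually.of_forall fun n => by positivity) ?_
      ((tendsto_natCast_mul_fieldSize_rpow hR0 hlam).mono_left hl)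
    filter_upwards [hmn] with n hn
    rw [one_mul]
    have := Real.rpow_le_rpow_of_exponent_le (one_lt_fieldSize lam n).le hβR
    gcongr
  · have hhalf := (tendsto_pow_atTop_nhds_zero_of_lt_one (r := (1 / 2 : ℝ)) (by norm_num)
      (by norm_num)).mono_left hl
    refine squeeze_zero' (Eventually.of_forall fun n => by positivity) ?_ hhalf
    have hP := (tendsto_fieldSize hlam0).mono_left hl
    filter_upwards [hm, hmn, ((tendsto_rpow_neg_atTop hR0).comp hP).eventually_le_const
      (show (0 : ℝ) < 1 / 4 by norm_num)] with n hn hn' hsmall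
    simp only [Function.comp_apply] at hsmall
    have hp : (0 : ℝ) < fieldSize lam n := one_pos.trans (one_lt_fieldSize lam n)
    have hle : m n ≤ n := by exact_mod_cast hn'
    have h1 : 1 / (fieldSize lam n : ℝ) ^ (n - m n) = ((fieldSize lam n : ℝ) ^ (-R)) ^ n := by
      rw [← Real.rpow_mul_natCast hp.le, one_div, ← Real.rpow_natCast, ← Real.rpow_neg hp.le,
        Nat.cast_sub hle, hn]
      congr 1; ring
    rw [← mul_one_div, h1]
    calc _ ≤ (2 : ℝ) ^ n * (1 / 4) ^ n := by gcongr; norm_num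
      _ = (1 / 2) ^ n := by rw [← mul_pow]; norm_num

end Asymptotics

/-! ### Choice of parameters and the two averages. -/

section Covering

variable {l : Filter ℕ} {lam R η : ℝ}

/-- The parameter of the Gaussian weight `exp (-a ‖u‖²)` on integer vectors, chosen such that the
total weight is about `(e^(2η - 1/2) p^(1-R))ⁿ`. -/
noncomputable def gaussParam (lam R η : ℝ) (n : ℕ) : ℝ :=
  Real.pi * Real.exp (1 - 4 * η) * ((fieldSize lam n : ℝ) ^ (-(1 - R))) ^ 2

/-- The largest integer `N` for which residues of integers in `[-N, N]` are distinct. -/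
noncomputable def halfSize (lam : ℝ) (n : ℕ) : ℕ := (fieldSize lam n - 1) / 2

/-- The covering radius aimed at. -/
noncomputable def coverRadius (lam R η : ℝ) (n : ℕ) : ℝ :=
  √((1 + η) * (n / (2 * gaussParam lam R η n)))

theorem fieldSize_pos (lam : ℝ) (n : ℕ) : (0 : ℝ) < fieldSize lam n :=
  one_pos.trans (one_lt_fieldSize lam n)

theorem gaussParam_pos (n : ℕ) : 0 < gaussParam lam R η n := by
  have := fieldSize_pos lam n
  have := Real.pi_pos
  rw [gaussParam]; positivity

theorem sqrt_gaussParam (n : ℕ) : √(gaussParam lam R η n) =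
    √Real.pi * Real.exp ((1 - 4 * η) / 2) * (fieldSize lam n : ℝ) ^ (-(1 - R)) := by
  have := fieldSize_pos lam n
  have hpi := Real.pi_pos
  rw [gaussParam, Real.sqrt_mul (by positivity), Real.sqrt_mul hpi.le,
    Real.sqrt_sq (by positivity), Real.sqrt_eq_rpow (Real.exp _), ← Real.exp_mul]
  congr 3; ring

theorem two_mul_halfSize_lt (n : ℕ) : 2 * halfSize lam n < fieldSize lam n := by
  have := (fieldSize_prime lam n).pos
  rw [halfSize]; omega

theorem tendsto_gaussParam (hR1 : R < 1) (hlam : 0 < lam) :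
    Tendsto (gaussParam lam R η) atTop (𝓝 0) := by
  have h := ((((tendsto_rpow_neg_atTop (show 0 < 1 - R by linarith)).comp
    (tendsto_fieldSize hlam)).pow 2).const_mul (Real.pi * Real.exp (1 - 4 * η)))
  rw [zero_pow two_ne_zero, mul_zero] at h
  exact h

/-- The product is of order `p · p^(-(1-R)) = p^R`: the cube can be kept narrower than `p` and still
hold almost all of the Gaussian weight. -/
theorem tendsto_halfSize_mul_sqrt (hR0 : 0 < R) (hlam : 0 < lam) :
    Tendsto (fun n => (halfSize lam n : ℝ) * √(gaussParam lam R η n)) atTop atTop := by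
  have hc : 0 < √Real.pi * Real.exp ((1 - 4 * η) / 2) / 4 := by
    have := Real.sqrt_pos.2 Real.pi_pos
    positivity
  have hP := tendsto_fieldSize hlam
  refine tendsto_atTop_mono' _ ?_ (((tendsto_rpow_atTop hR0).comp hP).const_mul_atTop hc)
  filter_upwards [hP.eventually_ge_atTop 4] with n hn
  have hp := fieldSize_pos lam n
  have h1 : fieldSize lam n ≤ 2 * halfSize lam n + 2 := by rw [halfSize]; omega
  have h2 : (fieldSize lam n : ℝ) ≤ 2 * halfSize lam n + 2 := by exact_mod_cast h1
  have h3 : (fieldSize lam n : ℝ) / 4 ≤ halfSize lam n := by linarith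
  have := Real.sqrt_nonneg Real.pi
  calc √Real.pi * Real.exp ((1 - 4 * η) / 2) / 4 * (fieldSize lam n : ℝ) ^ R
      = (fieldSize lam n : ℝ) / 4 * (√Real.pi * Real.exp ((1 - 4 * η) / 2) *
        (fieldSize lam n : ℝ) ^ (-(1 - R))) := by
        have : (fieldSize lam n : ℝ) ^ R =
            (fieldSize lam n : ℝ) ^ (1 : ℝ) * (fieldSize lam n : ℝ) ^ (-(1 - R)) := by
          rw [← Real.rpow_add hp]; congr 1; ring
        rw [this, Real.rpow_one]; ring
    _ ≤ _ := by rw [sqrt_gaussParam]; gcongr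

/-- The size of the theta series relative to `p^(1-R)`. -/
theorem tendsto_theta_mul_rpow (hl : l ≤ atTop) [l.IsCountablyGenerated] (hR0 : 0 < R)
    (hR1 : R < 1) (hlam : 0 < lam) {c : ℝ} (hc : 0 < c) :
    Tendsto (fun n => theta (halfSize lam n) (c * gaussParam lam R η n) *
      (fieldSize lam n : ℝ) ^ (-(1 - R))) l (𝓝 ((√c)⁻¹ * Real.exp (-(1 - 4 * η) / 2))) := by
  have h1 := tendsto_theta_ratio (fun n => gaussParam_pos (lam := lam) (R := R) (η := η) n)
    ((tendsto_gaussParam hR1 hlam).mono_left hl)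
    ((tendsto_halfSize_mul_sqrt (η := η) hR0 hlam).mono_left hl) hc
  have h2 := tendsto_theta_mul_sqrt (fun n => gaussParam_pos (lam := lam) (R := R) (η := η) n)
    ((tendsto_gaussParam hR1 hlam).mono_left hl)
    ((tendsto_halfSize_mul_sqrt (η := η) hR0 hlam).mono_left hl)
  have hpi := Real.sqrt_pos.2 Real.pi_pos
  have h3 := (h1.mul h2).mul_const ((√Real.pi)⁻¹ * Real.exp (-(1 - 4 * η) / 2))
  have h4 : (√c)⁻¹ * √Real.pi * ((√Real.pi)⁻¹ * Real.exp (-(1 - 4 * η) / 2)) =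
      (√c)⁻¹ * Real.exp (-(1 - 4 * η) / 2) := by field_simp
  rw [h4] at h3
  refine h3.congr fun n => ?_
  have h5 : 0 < theta (halfSize lam n) (gaussParam lam R η n) := one_pos.trans_le (one_le_theta _ _)
  have h6 : Real.exp ((1 - 4 * η) / 2) * Real.exp (-(1 - 4 * η) / 2) = 1 := by
    rw [← Real.exp_add]; ring_nf; simp
  rw [sqrt_gaussParam]
  calc _ = theta (halfSize lam n) (c * gaussParam lam R η n) *
        (fieldSize lam n : ℝ) ^ (-(1 - R)) *
        (Real.exp ((1 - 4 * η) / 2) * Real.exp (-(1 - 4 * η) / 2)) := by field_simp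
    _ = _ := by rw [h6, mul_one]

theorem norm_intPoint_le_coverRadius {n : ℕ} {u : Fin n → ℤ}
    (hu : u ∈ shell n (halfSize lam n) (gaussParam lam R η n) η) :
    ‖intPoint u‖ ≤ coverRadius lam R η n := by
  refine Real.le_sqrt_of_sq_le ?_
  rw [norm_intPoint_sq]
  exact (Finset.mem_filter.1 hu).2.2

/-- The expected proportion of residue vectors that are not covered is negligible. -/
theorem tendsto_avg_uncovered (hl : l ≤ atTop) [l.IsCountablyGenerated] (hR0 : 0 < R)
    (hR1 : R < 1) (hlam : 1 / R < lam) (hη : 0 < η) (hη1 : η < 1)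
    {α A β B ε ϑ : ℝ} {m : ℕ → ℕ} (hm : ∀ᶠ n in l, (m n : ℝ) = n * (1 - R))
    (g : (n : ℕ) → BipGraph (Fin n) (Fin (m n)))
    (hg : ∀ᶠ n in l, (g n).IsGood R α A β B ε ϑ) (hα : 1 ≤ α) (hβ : 1 / (1 - R) < β)
    (hB : 2 * (1 + R) / (1 - R) < B) (hϑ : 0 < ϑ) :
    Tendsto (fun n => (fieldSize lam n : ℝ) ^ (2 * R) *
      avg (fun h' : Fin (m n) → Fin n → ZMod (fieldSize lam n) =>
        ((uncovered (codeOf (g n) h') (coverRadius lam R η n)).card : ℝ) /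
          (fieldSize lam n : ℝ) ^ n)) l (𝓝 0) := by
  have hlam0 : 0 < lam := lt_trans (by positivity) hlam
  have hmn : ∀ᶠ n in l, (m n : ℝ) ≤ n := by
    filter_upwards [hm] with n hn
    rw [hn]; nlinarith [(Nat.cast_nonneg n : (0 : ℝ) ≤ n)]
  set a := gaussParam lam R η with ha
  set N := halfSize lam with hN
  set θ : ℕ → ℝ := fun n => theta (N n) (a n) with hθdef
  set Θ : ℕ → ℝ := fun n => theta (N n) (η * a n) with hΘdef
  have hθ1 : ∀ n, 1 ≤ θ n := fun n => one_le_theta _ _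
  have hΘ1 : ∀ n, 1 ≤ Θ n := fun n => one_le_theta _ _
  have hmulrpow : ∀ n, (fieldSize lam n : ℝ) ^ (-(1 - R)) * (fieldSize lam n : ℝ) ^ (1 - R) = 1 := by
    intro n
    rw [← Real.rpow_add (fieldSize_pos lam n)]; simp
  -- The limit has `4η` in place of `3η`; the difference is the room needed for an eventual
  -- inequality.
  have hθ : ∀ᶠ n in l,
      Real.exp (-(1 - 3 * η) / 2) * (fieldSize lam n : ℝ) ^ (1 - R) ≤ θ n := by
    have h := tendsto_theta_mul_rpow (η := η) hl hR0 hR1 hlam0 one_pos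
    rw [Real.sqrt_one, inv_one, one_mul] at h
    filter_upwards [h.eventually_const_le
      (show Real.exp (-(1 - 3 * η) / 2) < _ from Real.exp_lt_exp.2 (by linarith))] with n hn
    have := fieldSize_pos lam n
    calc _ ≤ _ := mul_le_mul_of_nonneg_right hn (by positivity)
      _ = θ n := by rw [mul_assoc, hmulrpow, one_mul, mul_one]
  obtain ⟨C, hΘ⟩ : ∃ C : ℝ, ∀ᶠ n in l, Θ n ≤ C * (fieldSize lam n : ℝ) ^ (1 - R) := by
    refine ⟨(√η)⁻¹ * Real.exp (-(1 - 4 * η) / 2) + 1, ?_⟩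
    filter_upwards [(tendsto_theta_mul_rpow (η := η) hl hR0 hR1 hlam0 hη).eventually_le_const
      (lt_add_one _)] with n hn
    have := fieldSize_pos lam n
    calc Θ n = Θ n * (fieldSize lam n : ℝ) ^ (-(1 - R)) * (fieldSize lam n : ℝ) ^ (1 - R) := by
          rw [mul_assoc, hmulrpow, mul_one]
      _ ≤ _ := mul_le_mul_of_nonneg_right hn (by positivity)
  have hshell := eventually_theta_pow_le hl (fun n => gaussParam_pos (lam := lam) (R := R) (η := η) n)
    ((tendsto_gaussParam hR1 hlam0).mono_left hl)
    ((tendsto_halfSize_mul_sqrt (η := η) hR0 hlam0).mono_left hl) hη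
  have hc := Real.exp_pos (-(1 - 3 * η) / 2)
  have t1 := (tendsto_small_sets hl hR0 hR1 hlam hmn hθ1 hc hθ hB).const_mul 2
  obtain ⟨hy, t2⟩ := tendsto_medium_sets hl hR1 hlam0 hmn hθ1 hc hθ hβ hϑ
  have t3 := (tendsto_large_sets hl hR0 hlam hm hΘ1 hη hθ hΘ).const_mul 2
  have t := (t1.add (t2.const_mul 2)).add t3
  rw [mul_zero, add_zero, add_zero] at t
  refine squeeze_zero' (Eventually.of_forall fun n => ?_) ?_ t
  · exact mul_nonneg (Real.rpow_nonneg (fieldSize_pos lam n).le _)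
      (avg_nonneg fun h' => div_nonneg (Nat.cast_nonneg _) (pow_nonneg (Nat.cast_nonneg _) _))
  filter_upwards [hm, hg, hshell, hy] with n hmn hgn hsh hyn
  have hp1 := one_lt_fieldSize lam n
  have hp := fieldSize_pos lam n
  have ha0 : 0 < a n := gaussParam_pos n
  have hθ0 : 0 < θ n := one_pos.trans_le (hθ1 n)
  have hM : 0 < ∑ u ∈ shell n (N n) (a n) η, Real.exp (-a n * normSq u) := by
    have : 0 < θ n ^ n := by positivity
    change θ n ^ n ≤ _ at hsh
    linarith
  have h1 := avg_card_uncovered_le (p := fieldSize lam n) (g n)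
    (shell n (N n) (a n) η) (fun u => Real.exp (-a n * normSq u))
    (fun u hu => norm_intPoint_le_coverRadius hu) (fun _ _ => (Real.exp_pos _).le) hM
  have h2 := sum_pow_mul_le_of_isGood (θ := θ n) (Θ := Θ n) (p := fieldSize lam n)
    (E := Real.exp (-((1 - η) ^ 2 * n / 2)))
    (f := collision (fieldSize lam n) (shell n (N n) (a n) η) fun u => Real.exp (-a n * normSq u))
    hgn hmn hα hp1.le (hθ1 n) (Real.exp_pos _).le (hΘ1 n) hyn ?_ ?_
  · calc _ ≤ _ := mul_le_mul_of_nonneg_left (h1.trans h2) (by positivity)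
      _ = _ := by ring
  · intro Z
    -- Here `b = 0`: the norm is not used and every agreeing coordinate saves a factor `θ`.
    have h := collision_shell_le (two_mul_halfSize_lt (lam := lam) n) le_rfl ha0.le hsh Z
    have hZ : Z.card ≤ n := (Finset.card_le_univ Z).trans (Fintype.card_fin n).le
    have hpow : theta (N n) (a n) ^ n = θ n ^ (n - Z.card) * θ n ^ Z.card := by
      rw [← pow_add, Nat.sub_add_cancel hZ]
    refine h.trans (le_of_eq ?_)
    rw [hpow, neg_zero, zero_mul, Real.exp_zero, mul_one, sub_zero]
    change 2 * θ n ^ (n - Z.card) / _ = _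
    field_simp
  · intro Z
    -- With `b = a` the free coordinates would cost `2N + 1`, about `p`, and `(1 + Θ/p)^m` would be
    -- exponential. Keeping `η a` leaves `Θ` of order `p^(1-R)`.
    have h := collision_shell_le (b := (1 - η) * a n) (two_mul_halfSize_lt (lam := lam) n)
      (by nlinarith) (by nlinarith) hsh Z
    refine h.trans (le_of_eq ?_)
    rw [show a n - (1 - η) * a n = η * a n by ring,
      show -((1 - η) * a n) * ((1 - η) * (n / (2 * a n))) = -((1 - η) ^ 2 * n / 2) by field_simp]

theorem tendsto_avg_card_codeOf (hl : l ≤ atTop) (hR0 : 0 < R)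
    (hR1 : R < 1) (hlam : 1 / R < lam)
    {α A β B ε ϑ : ℝ} {m : ℕ → ℕ} (hm : ∀ᶠ n in l, (m n : ℝ) = n * (1 - R))
    (g : (n : ℕ) → BipGraph (Fin n) (Fin (m n)))
    (hg : ∀ᶠ n in l, (g n).IsGood R α A β B ε ϑ) (hα : 1 ≤ α) (hβ : 1 / (1 - R) < β) :
    Tendsto (fun n => avg (fun h' : Fin (m n) → Fin n → ZMod (fieldSize lam n) =>
      (Nat.card (codeOf (g n) h') : ℝ) * (fieldSize lam n : ℝ) ^ m n /
        (fieldSize lam n : ℝ) ^ n - 1)) l (𝓝 0) := by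
  refine squeeze_zero' (Eventually.of_forall fun n => ?_) ?_ (tendsto_rank_sets hl hR0 hR1 hlam hm hβ)
  · refine avg_nonneg fun h' => ?_
    have hp := fieldSize_pos lam n
    rw [sub_nonneg, le_div_iff₀ (by positivity), one_mul]
    exact_mod_cast pow_le_card_mul_pow (g n) h'
  filter_upwards [hm, hg] with n hmn hgn
  refine (avg_card_codeOf_le (g n)).trans
    (sum_pow_div_le_of_isGood hgn hmn hα (one_lt_fieldSize lam n).le ?_)
  have : (m n : ℝ) ≤ n := by rw [hmn]; nlinarith [(Nat.cast_nonneg n : (0 : ℝ) ≤ n)]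
  exact_mod_cast this

/-- The bound on the normalized second moment that covering with radius `coverRadius` gives. -/
theorem tendsto_coverRadius_add_sq (hR1 : R < 1) (hlam : 0 < lam) (hη : 0 < η) :
    Tendsto (fun n : ℕ => (coverRadius lam R η n + √n) ^ 2 / n / (fieldSize lam n : ℝ) ^ (2 * (1 - R)))
      atTop (𝓝 ((1 + η) * Real.exp (4 * η) / (2 * Real.pi * Real.exp 1))) := by
  set D := (1 + η) * Real.exp (4 * η) / (2 * Real.pi * Real.exp 1) with hD
  have hD0 : 0 ≤ D := by have := Real.pi_pos; positivity
  -- The expression equals `(√D + p^(-(1-R)))²`: the rounding term `√n` is negligible against the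
  -- radius.
  have h := (((tendsto_rpow_neg_atTop (show 0 < 1 - R by linarith)).comp
    (tendsto_fieldSize hlam)).const_add √D).pow 2
  rw [add_zero, Real.sq_sqrt hD0] at h
  refine h.congr' ?_
  filter_upwards [eventually_ge_atTop 1] with n hn
  have hn' : (0 : ℝ) < n := by exact_mod_cast hn
  have hp := fieldSize_pos lam n
  have hpi := Real.pi_pos
  set P := (fieldSize lam n : ℝ) ^ (1 - R) with hP
  have hP0 : 0 < P := by positivity
  have h1 : (fieldSize lam n : ℝ) ^ (-(1 - R)) = P⁻¹ := Real.rpow_neg hp.le _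
  have h2 : (fieldSize lam n : ℝ) ^ (2 * (1 - R)) = P ^ 2 := by
    rw [hP, ← Real.rpow_mul_natCast hp.le]; congr 1; push_cast; ring
  have h3 : coverRadius lam R η n = √D * √n * P := by
    rw [coverRadius, gaussParam, h1]
    have : (1 + η) * (n / (2 * (Real.pi * Real.exp (1 - 4 * η) * P⁻¹ ^ 2))) = D * n * P ^ 2 := by
      rw [hD, Real.exp_sub]; field_simp
    rw [this, Real.sqrt_mul (by positivity), Real.sqrt_mul hD0, Real.sqrt_sq hP0.le]
  simp only [Function.comp_apply]
  rw [h1, h2, h3]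
  have h4 : (√(n : ℝ)) ^ 2 = n := Real.sq_sqrt hn'.le
  have h5 : (√D * √n * P + √n) ^ 2 = n * (√D * P + 1) ^ 2 := by
    rw [← h4]
    have : √((√(n : ℝ)) ^ 2) = √n := by rw [h4]
    rw [this]; ring
  rw [h5]
  field_simp

/-- `|K|` is a power of `p` and at least the generic value, so an excess by a factor below 2 is no
excess at all. -/
theorem card_codeOf_mul_pow_eq {n m p : ℕ} [Fact p.Prime] (g : BipGraph (Fin n) (Fin m))
    (h' : Fin m → Fin n → ZMod p)
    (h : (Nat.card (codeOf g h') : ℝ) * (p : ℝ) ^ m / (p : ℝ) ^ n - 1 < 1) :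
    Nat.card (codeOf g h') * p ^ m = p ^ n := by
  have hp := (Fact.out : p.Prime)
  have hp0 : (0 : ℝ) < p := by exact_mod_cast hp.pos
  have h1 : (Nat.card (codeOf g h') : ℝ) * (p : ℝ) ^ m < 2 * (p : ℝ) ^ n := by
    rw [← div_lt_iff₀ (by positivity)]; linarith
  have h2 : Nat.card (codeOf g h') * p ^ m < 2 * p ^ n := by exact_mod_cast h1
  have h3 := pow_le_card_mul_pow g h'
  rw [Module.natCard_eq_pow_finrank (K := ZMod p), Nat.card_zmod, ← pow_add] at *
  have h4 := (Nat.pow_le_pow_iff_right hp.one_lt).1 h3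
  rcases h4.eq_or_lt with h5 | h5
  · exact congrArg (p ^ ·) h5.symm
  · exfalso
    have h6 := Nat.pow_le_pow_right hp.pos h5
    rw [pow_succ] at h6
    have h7 := Nat.mul_le_mul_left (p ^ n) hp.two_le
    omega

open Classical in
theorem ensemble_toOuterMeasure {n m : ℕ} (g : BipGraph (Fin n) (Fin m)) (lam : ℝ)
    (S : Set (Submodule ℤ (EuclideanSpace ℝ (Fin n)))) :
    (ensemble g lam).toOuterMeasure S = ENNReal.ofReal (avg
      (fun h' : Fin m → Fin n → ZMod (fieldSize lam n) =>
        if constructionA (codeOf g h') ∈ S then (1 : ℝ) else 0)) := by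
  rw [ensemble, PMF.toOuterMeasure_map_apply, PMF.toOuterMeasure_uniformOfFintype_apply, avg,
    Finset.sum_boole, ENNReal.ofReal_div_of_pos card_matrices_pos, ENNReal.ofReal_natCast,
    ENNReal.ofReal_natCast, ← Fintype.card_subtype]
  rfl

end Covering

end LDA

/-! ### Conclusion by Markov's inequality. -/

theorem mainTheorem3
    (R α A β B lam : ℝ) (dV dC : ℕ)
    (hR0 : 0 < R) (hR1 : R < 1) (hRd : R = 1 - (dV : ℝ) / (dC : ℝ))
    (hα : 1 ≤ α) (hαA : α < A)
    (hβ : 1 / (1 - R) < β) (hβ' : β < min (2 / (1 - R)) B)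
    (hA : 2 * (1 + R) < A) (hB : 2 * (1 + R) / (1 - R) < B)
    (ε ϑ : ℝ) (hε : ε = (1 - R) / (A + 1 - R)) (hϑ : ϑ = 1 / (B * (1 - R) + 1))
    (hdV : LDA.DegreeCondition dV R α A β B ε ϑ)
    (hlam1 : 1 / R < lam) (hlam2 : 1 / (1 - R) < lam)
    (hlam3 : 2 / (A - 2 * (1 + R)) < lam)
    (hlam4 : 2 / (B * (1 - R) - 2 * (1 + R)) < lam)
    (hlam5 : 2 * (1 - 1 / (A * B - 1) - 1 / A)⁻¹ < lam)
    (I : Set ℕ) (hI : I.Infinite)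
    (m : ℕ → ℕ) (hm : ∀ n ∈ I, (m n : ℝ) = (n : ℝ) * (dV : ℝ) / (dC : ℝ))
    (g : (n : ℕ) → LDA.BipGraph (Fin n) (Fin (m n)))
    (hreg : ∀ n ∈ I, (g n).IsBiregular dV dC)
    (hgood : ∀ n ∈ I, (g n).IsGood R α A β B ε ϑ)
    (δ : ℝ) (hδ : 0 < δ) :
    Tendsto
      (fun n : ℕ => (LDA.ensemble (g n) lam).toOuterMeasure
        {L | |LDA.secondMoment L - 1 / (2 * Real.pi * Real.exp 1)| ≤ δ})
      (atTop ⊓ 𝓟 I) (𝓝 1) := by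
  classical
  set l : Filter ℕ := atTop ⊓ 𝓟 I with hldef
  have hl : l ≤ atTop := inf_le_left
  have hmem : ∀ᶠ n in l, n ∈ I := by
    rw [hldef, eventually_inf_principal]
    exact Eventually.of_forall fun n hn => hn
  have hm' : ∀ᶠ n in l, (m n : ℝ) = n * (1 - R) := by
    filter_upwards [hmem] with n hn
    rw [hm n hn, hRd]; ring
  have hg : ∀ᶠ n in l, (g n).IsGood R α A β B ε ϑ := by
    filter_upwards [hmem] with n hn using hgood n hn
  have hlam0 : 0 < lam := lt_trans (by positivity) hlam1
  have hB0 : 0 < B := lt_trans (div_pos (by linarith) (by linarith)) hB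
  have hϑ0 : 0 < ϑ := by
    have : 0 < 1 - R := by linarith
    rw [hϑ]; positivity
  set G := 1 / (2 * Real.pi * Real.exp 1) with hG
  -- The limit of the covering term is continuous in `η` and equals `1/(2πe)` at `η = 0`. Half of
  -- `δ` is reserved for the uncovered part.
  obtain ⟨η, hη0, hη1, hηδ⟩ : ∃ η : ℝ, 0 < η ∧ η < 1 ∧
      (1 + η) * Real.exp (4 * η) / (2 * Real.pi * Real.exp 1) < G + δ / 2 := by
    have hcont : Continuous fun η : ℝ =>
        (1 + η) * Real.exp (4 * η) / (2 * Real.pi * Real.exp 1) := by fun_prop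
    have ht := (hcont.tendsto 0).mono_left (nhdsWithin_le_nhds (s := Set.Ioi 0))
    have h0 : (1 + 0) * Real.exp (4 * 0) / (2 * Real.pi * Real.exp 1) < G + δ / 2 := by
      simp only [add_zero, mul_zero, Real.exp_zero, mul_one]
      linarith
    obtain ⟨η, h1, h2, h3⟩ := ((ht.eventually_lt_const h0).and
      ((eventually_mem_nhdsWithin (a := (0 : ℝ)) (s := Set.Ioi 0)).and
        ((eventually_lt_nhds (show (0 : ℝ) < 1 from one_pos)).filter_mono nhdsWithin_le_nhds))).exists
    exact ⟨η, h2, h3, h1⟩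
  have tX := (LDA.tendsto_avg_uncovered hl hR0 hR1 hlam1 hη0 hη1 hm' g hg hα hβ hB hϑ0).div_const
    (δ / 2)
  have tY := LDA.tendsto_avg_card_codeOf hl hR0 hR1 hlam1 hm' g hg hα hβ
  have tlow := (tX.add tY).const_sub 1
  rw [zero_div, add_zero, sub_zero] at tlow
  have hr := ((LDA.tendsto_coverRadius_add_sq hR1 hlam0 hη0).mono_left hl).eventually_le_const hηδ
  have hn1 : ∀ᶠ n : ℕ in l, 1 ≤ n := hl (eventually_ge_atTop 1)
  have key : ∀ᶠ n in l,
      1 - ((LDA.fieldSize lam n : ℝ) ^ (2 * R) *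
        LDA.avg (fun h' : Fin (m n) → Fin n → ZMod (LDA.fieldSize lam n) =>
          ((LDA.uncovered (LDA.codeOf (g n) h') (LDA.coverRadius lam R η n)).card : ℝ) /
            (LDA.fieldSize lam n : ℝ) ^ n) / (δ / 2) +
        LDA.avg (fun h' : Fin (m n) → Fin n → ZMod (LDA.fieldSize lam n) =>
          (Nat.card (LDA.codeOf (g n) h') : ℝ) * (LDA.fieldSize lam n : ℝ) ^ m n /
            (LDA.fieldSize lam n : ℝ) ^ n - 1)) ≤
      LDA.avg (fun h' : Fin (m n) → Fin n → ZMod (LDA.fieldSize lam n) =>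
        if LDA.constructionA (LDA.codeOf (g n) h') ∈
          {L | |LDA.secondMoment L - G| ≤ δ} then (1 : ℝ) else 0) := by
    filter_upwards [hr, hn1, hm'] with n hrn hn hmn
    have hp := LDA.fieldSize_pos lam n
    have hn' : (0 : ℝ) < n := by exact_mod_cast hn
    set X : (Fin (m n) → Fin n → ZMod (LDA.fieldSize lam n)) → ℝ := fun h' =>
      ((LDA.uncovered (LDA.codeOf (g n) h') (LDA.coverRadius lam R η n)).card : ℝ) /
        (LDA.fieldSize lam n : ℝ) ^ n with hX
    set Y : (Fin (m n) → Fin n → ZMod (LDA.fieldSize lam n)) → ℝ := fun h' =>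
      (Nat.card (LDA.codeOf (g n) h') : ℝ) * (LDA.fieldSize lam n : ℝ) ^ m n /
        (LDA.fieldSize lam n : ℝ) ^ n - 1 with hY
    -- Markov's inequality pointwise: if the left side is positive, then `Y < 1` and `p^(2R) X <
    -- δ/2`, which together force the second moment to be within `δ`.
    have hsub : ∀ h', 1 - ((LDA.fieldSize lam n : ℝ) ^ (2 * R) * X h' / (δ / 2) + Y h') ≤
        if LDA.constructionA (LDA.codeOf (g n) h') ∈
          {L | |LDA.secondMoment L - G| ≤ δ} then (1 : ℝ) else 0 := by
      intro h'
      have hX0 : 0 ≤ X h' := by simp only [hX]; positivity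
      have hXd : 0 ≤ (LDA.fieldSize lam n : ℝ) ^ (2 * R) * X h' / (δ / 2) := by positivity
      have hY0 : 0 ≤ Y h' := by
        simp only [hY]
        rw [sub_nonneg, le_div_iff₀ (by positivity), one_mul]
        exact_mod_cast LDA.pow_le_card_mul_pow (g n) h'
      split_ifs with hin
      · linarith
      · by_contra! hcon
        refine hin ?_
        have hY1 : Y h' < 1 := by linarith
        have hX1 : (LDA.fieldSize lam n : ℝ) ^ (2 * R) * X h' < δ / 2 := by
          have : (LDA.fieldSize lam n : ℝ) ^ (2 * R) * X h' / (δ / 2) < 1 := by linarith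
          rwa [div_lt_one (by positivity)] at this
        have hcard := LDA.card_codeOf_mul_pow_eq (g n) h' hY1
        have hup := LDA.secondMoment_le hn hcard (LDA.coverRadius lam R η n)
        have hlow := LDA.le_secondMoment hn (LDA.codeOf (g n) h')
        have hexp : 2 * (m n : ℝ) / n = 2 * (1 - R) := by rw [hmn]; field_simp
        rw [hexp, add_div] at hup
        -- The origin of the weight `p^(2R)`: an uncovered cell costs up to `p²` per dimension,
        -- measured against `p^(2(1-R))`, the squared scale of the lattice.
        have hPow : X h' * (LDA.fieldSize lam n : ℝ) ^ 2 /
            (LDA.fieldSize lam n : ℝ) ^ (2 * (1 - R)) =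
            (LDA.fieldSize lam n : ℝ) ^ (2 * R) * X h' := by
          rw [mul_div_assoc, ← Real.rpow_natCast, ← Real.rpow_sub hp, mul_comm]
          congr 2; push_cast; ring
        change _ ≤ _ + X h' * (LDA.fieldSize lam n : ℝ) ^ 2 / _ at hup
        rw [hPow] at hup
        rw [← hG] at hlow
        rw [Set.mem_ofPred_eq]
        rw [abs_of_nonneg (by linarith)]
        linarith
    refine le_trans (le_of_eq ?_) (LDA.avg_mono hsub)
    simp only [LDA.avg, Finset.sum_sub_distrib, Finset.sum_add_distrib, ← Finset.mul_sum,
      ← Finset.sum_div]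
    have hcardpos := LDA.card_matrices_pos (n := n) (m := m n) (p := LDA.fieldSize lam n)
    rw [Finset.sum_const, nsmul_eq_mul, mul_one, Finset.card_univ]
    field_simp
  have hle1 : ∀ n, LDA.avg (fun h' : Fin (m n) → Fin n → ZMod (LDA.fieldSize lam n) =>
      if LDA.constructionA (LDA.codeOf (g n) h') ∈
        {L | |LDA.secondMoment L - G| ≤ δ} then (1 : ℝ) else 0) ≤ 1 := by
    intro n
    rw [LDA.avg, div_le_one LDA.card_matrices_pos, Finset.sum_boole]
    exact_mod_cast Finset.card_le_univ _
  have tfin := tendsto_of_tendsto_of_tendsto_of_le_of_le' tlow tendsto_const_nhds key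
    (Eventually.of_forall hle1)
  have := ENNReal.tendsto_ofReal tfin
  rw [ENNReal.ofReal_one] at this
  exact this.congr fun n => (LDA.ensemble_toOuterMeasure (g n) lam _).symm
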